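/- Let $\Bbbk$ be an algebraically closed field of characteristic zero. Let $X=\operatorname{Spec}\Bbbk[X]$ be a smooth affine supervariety over $\Bbbk$, i.e. $\Bbbk[X]=\Bbbk[X]_{\bar 0}\oplus\Bbbk[X]_{\bar 1}$ is a finitely generated supercommutative $\Bbbk$-superalgebra which is smooth over $\Bbbk$ (morphisms of superalgebras from $\Bbbk[X]$ lift along surjections of supercommutative $\Bbbk$-superalgebras with nilpotent kernel). For a $\Bbbk$-point $x\in X(\Bbbk)$ with maximal ideal $\mathfrak m_x\subset\Bbbk[X]$ write $T_x^*X=\mathfrak m_x/\mathfrak m_x^2=(T_x^*X)_{\bar 0}\oplus(T_x^*X)_{\bar 1}$ for the cotangent space, and let $X_0$ be the underlying even variety, with $\Bbbk[X_0]=\Bbbk[X]/(\Bbbk[X]_{\bar 1})$. Let $u$ be an odd vector field on $X$ (an odd $\Bbbk$-linear superderivation of $\Bbbk[X]$) which is homological, i.e. $u^2$ acts semisimply on $\Bbbk[X]$, and which vanishes everywhere, i.e. $u(f)(x)=0$ for all $f\in\Bbbk[X]$ and $x\in X(\Bbbk)$; thus $u$ induces an odd linear map on each $T_x^*X$. Suppose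 that for all $x\in X(\Bbbk)$: 1. $u\big((T_x^*X)_{\bar 1}\big)=0$; 2. the map $u:(T_x^*X)_{\bar 0}\to(T_x^*X)_{\bar 1}$ is an isomorphism. Let $\Pi T_{X_0}$ be the supervariety whose algebra of functions is the algebra of algebraic differential forms $\Omega^\bullet_{X_0}=\bigwedge_{\Bbbk[X_0]}\Omega_{\Bbbk[X_0]/\Bbbk}$, with $\mathbb Z/2$-grading given by the parity of the degree of forms. Then there is an isomorphism of supervarieties $X\cong\Pi T_{X_0}$ under which $u$ corresponds to the de Rham differential; that is, there is a parity-preserving isomorphism of $\Bbbk$-algebras $\varphi:\Bbbk[X]\to\Omega^\bullet_{X_0}$ with $\varphi\circ u=d\circ\varphi$. -/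

import Mathlib

open scoped KaehlerDifferential

universe u v

noncomputable section

namespace SuperGeom

/-! ## The algebraic de Rham complex -/

section DeRham

variable (k : Type u) (B : Type v) [CommRing k] [CommRing B] [Algebra k B]

/-- The algebra `Ω^•_{B/k}` of algebraic differential forms: the exterior algebra over `B` of the
module of Kähler differentials. -/
abbrev Forms : Type v := ExteriorAlgebra B Ω[B⁄k]

/-- The parity decomposition of the algebra of differential forms: `Forms.parity k B 0` consists of
the sums of forms of even degree, `Forms.parity k B 1` of the sums of forms of odd degree. -/
def Forms.parity (i : ZMod 2) : Submodule B (Forms k B) :=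
  CliffordAlgebra.evenOdd (0 : QuadraticForm B Ω[B⁄k]) i

/-- The sign automorphism of the algebra of forms, `ω ↦ (-1)^{deg ω} ω`. -/
def Forms.sign : Forms k B →ₐ[B] Forms k B :=
  CliffordAlgebra.involute (Q := (0 : QuadraticForm B Ω[B⁄k]))

/-- The differential `db`, as an element of the algebra of forms. -/
def Forms.ofD (b : B) : Forms k B := ExteriorAlgebra.ι B (KaehlerDifferential.D k B b)

variable {k B}

@[simp] theorem Forms.sign_ι (ω : Ω[B⁄k]) :
    Forms.sign k B (ExteriorAlgebra.ι B ω) = -ExteriorAlgebra.ι B ω :=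
  CliffordAlgebra.involute_ι (Q := (0 : QuadraticForm B Ω[B⁄k])) ω

theorem Forms.ι_mul (ω : Ω[B⁄k]) (a : Forms k B) :
    ExteriorAlgebra.ι B ω * a = Forms.sign k B a * ExteriorAlgebra.ι B ω := by
  induction a using ExteriorAlgebra.induction with
  | algebraMap r => rw [AlgHom.commutes]; exact (Algebra.commutes r _).symm
  | ι η =>
    rw [Forms.sign_ι, neg_mul]
    exact eq_neg_of_add_eq_zero_left (ExteriorAlgebra.ι_add_mul_swap ω η)
  | mul a b ha hb => rw [map_mul, ← mul_assoc, ha, mul_assoc, hb, mul_assoc]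
  | add a b ha hb => rw [map_add, mul_add, add_mul, ha, hb]

variable (k B)

/-- Auxiliary ring for the construction of the de Rham differential: pairs `(a, m)` of forms,
standing for `a + ε m` with `ε` an odd parameter of square zero. -/
@[ext] structure Jet : Type v where
  fst : Forms k B
  snd : Forms k B

namespace Jet

variable {k B}

instance : Zero (Jet k B) := ⟨⟨0, 0⟩⟩
instance : One (Jet k B) := ⟨⟨1, 0⟩⟩
instance : Add (Jet k B) := ⟨fun p q => ⟨p.fst + q.fst, p.snd + q.snd⟩⟩
instance : Neg (Jet k B) := ⟨fun p => ⟨-p.fst, -p.snd⟩⟩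
instance : Mul (Jet k B) :=
  ⟨fun p q => ⟨p.fst * q.fst, p.snd * q.fst + Forms.sign k B p.fst * q.snd⟩⟩

@[simp] theorem zero_fst : (0 : Jet k B).fst = 0 := rfl
@[simp] theorem zero_snd : (0 : Jet k B).snd = 0 := rfl
@[simp] theorem one_fst : (1 : Jet k B).fst = 1 := rfl
@[simp] theorem one_snd : (1 : Jet k B).snd = 0 := rfl
@[simp] theorem add_fst (p q : Jet k B) : (p + q).fst = p.fst + q.fst := rfl
@[simp] theorem add_snd (p q : Jet k B) : (p + q).snd = p.snd + q.snd := rfl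
@[simp] theorem neg_fst (p : Jet k B) : (-p).fst = -p.fst := rfl
@[simp] theorem neg_snd (p : Jet k B) : (-p).snd = -p.snd := rfl
@[simp] theorem mul_fst (p q : Jet k B) : (p * q).fst = p.fst * q.fst := rfl
@[simp] theorem mul_snd (p q : Jet k B) :
    (p * q).snd = p.snd * q.fst + Forms.sign k B p.fst * q.snd := rfl

instance : Ring (Jet k B) where
  add_assoc p q r := by ext <;> simp [add_assoc]
  zero_add p := by ext <;> simp
  add_zero p := by ext <;> simp
  add_comm p q := by ext <;> simp [add_comm]
  nsmul := nsmulRec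
  zsmul := zsmulRec
  neg_add_cancel p := by ext <;> simp
  left_distrib p q r := by
    ext
    · simp [mul_add]
    · simp only [mul_snd, add_fst, add_snd, mul_add]; abel
  right_distrib p q r := by
    ext
    · simp [add_mul]
    · simp only [mul_snd, add_fst, add_snd, add_mul, map_add]; abel
  zero_mul p := by ext <;> simp
  mul_zero p := by ext <;> simp
  mul_assoc p q r := by
    ext
    · simp [mul_assoc]
    · simp only [mul_snd, mul_fst, map_mul, add_mul, mul_add, mul_assoc, add_assoc]
  one_mul p := by ext <;> simp
  mul_one p := by ext <;> simp

/-- The ring homomorphism `b ↦ b + ε db`. -/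
def ofBase : B →+* Jet k B where
  toFun b := ⟨algebraMap B _ b, Forms.ofD k B b⟩
  map_one' := by ext <;> simp [Forms.ofD]
  map_zero' := by ext <;> simp [Forms.ofD]
  map_add' a b := by ext <;> simp [Forms.ofD]
  map_mul' a b := by
    ext
    · simp
    · simp only [Forms.ofD, Derivation.leibniz, map_add, map_smul, mul_snd, AlgHom.commutes,
        Algebra.smul_def]
      rw [Algebra.commutes b, add_comm]

instance : Algebra B (Jet k B) :=
  ofBase.toAlgebra' fun b p => by
    ext
    · exact Algebra.commutes b p.fst
    · change Forms.ofD k B b * p.fst + Forms.sign k B (algebraMap B _ b) * p.snd =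
        p.snd * algebraMap B _ b + Forms.sign k B p.fst * Forms.ofD k B b
      rw [AlgHom.commutes, Forms.ofD, Forms.ι_mul, Algebra.commutes b p.snd, add_comm]

theorem algebraMap_def (b : B) :
    algebraMap B (Jet k B) b = ⟨algebraMap B _ b, Forms.ofD k B b⟩ := rfl

theorem smul_def' (b : B) (p : Jet k B) :
    b • p = ⟨b • p.fst, Forms.ofD k B b * p.fst + b • p.snd⟩ := by
  rw [Algebra.smul_def, algebraMap_def]
  ext
  · simp [Algebra.smul_def]
  · simp [Algebra.smul_def]

instance : Algebra k (Jet k B) :=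
  ((algebraMap B (Jet k B)).comp (algebraMap k B)).toAlgebra' fun c p =>
    Algebra.commutes (algebraMap k B c) p

instance : IsScalarTower k B (Jet k B) := IsScalarTower.of_algebraMap_eq fun _ => rfl

theorem base_smul (c : k) (p : Jet k B) : c • p = ⟨c • p.fst, c • p.snd⟩ := by
  rw [← algebraMap_smul B c p, smul_def']
  ext <;> simp [Forms.ofD]

/-- The derivation `b ↦ db + ε d(db) = db`. -/
def der : Derivation k B (Jet k B) where
  toFun b := ⟨Forms.ofD k B b, 0⟩
  map_add' a b := by ext <;> simp [Forms.ofD]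
  map_smul' c b := by
    rw [RingHom.id_apply, base_smul]
    ext <;> simp [Forms.ofD]
  map_one_eq_zero' := by
    ext <;> simp [Forms.ofD]
  leibniz' a b := by
    change (⟨Forms.ofD k B (a * b), 0⟩ : Jet k B) =
      a • (⟨Forms.ofD k B b, 0⟩ : Jet k B) + b • (⟨Forms.ofD k B a, 0⟩ : Jet k B)
    rw [smul_def', smul_def']
    ext
    · simp [Forms.ofD]
    · simp [Forms.ofD]

/-- The map `ω ↦ ω + ε dω` on `1`-forms. -/
def ofOneForm : Ω[B⁄k] →ₗ[B] Jet k B := der.liftKaehlerDifferential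

theorem ofOneForm_D (b : B) :
    ofOneForm (KaehlerDifferential.D k B b) = ⟨Forms.ofD k B b, 0⟩ :=
  der.liftKaehlerDifferential_comp_D b

theorem ofOneForm_spec (ω : Ω[B⁄k]) :
    (ofOneForm ω).fst = ExteriorAlgebra.ι B ω ∧
      Forms.sign k B (ofOneForm ω).snd = (ofOneForm ω).snd := by
  have h : ω ∈ Submodule.span B (Set.range (KaehlerDifferential.D k B)) := by
    rw [KaehlerDifferential.span_range_derivation]; trivial
  induction h using Submodule.span_induction with
  | mem x hx =>
    obtain ⟨b, rfl⟩ := hx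
    rw [ofOneForm_D]
    exact ⟨rfl, map_zero _⟩
  | zero => simp
  | add x y _ _ hx hy => simp [hx.1, hx.2, hy.1, hy.2]
  | smul b x _ hx =>
    rw [map_smul, smul_def', hx.1]
    refine ⟨by simp, ?_⟩
    simp [hx.2, Forms.ofD]

theorem ofOneForm_sq (ω : Ω[B⁄k]) : ofOneForm ω * ofOneForm ω = 0 := by
  obtain ⟨h1, h2⟩ := ofOneForm_spec ω
  ext
  · simp [h1]
  · rw [mul_snd, h1, Forms.sign_ι, neg_mul, Forms.ι_mul, h2, zero_snd]
    abel

/-- The algebra homomorphism `a ↦ a + ε da`. -/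
def taylor : Forms k B →ₐ[B] Jet k B :=
  ExteriorAlgebra.lift B ⟨ofOneForm, ofOneForm_sq⟩

theorem taylor_ι (ω : Ω[B⁄k]) : taylor (ExteriorAlgebra.ι B ω) = ofOneForm ω :=
  ExteriorAlgebra.lift_ι_apply B _ _ _

theorem taylor_fst (a : Forms k B) : (taylor a).fst = a := by
  induction a using ExteriorAlgebra.induction with
  | algebraMap r => rw [AlgHom.commutes]; rfl
  | ι ω => rw [taylor_ι, (ofOneForm_spec ω).1]
  | mul a b ha hb => rw [map_mul, mul_fst, ha, hb]
  | add a b ha hb => rw [map_add, add_fst, ha, hb]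

end Jet

/-- The de Rham differential `d : Ω^•_{B/k} → Ω^•_{B/k}`. It is the odd `k`-linear derivation with
`d b = db` and `d (db) = 0` for `b : B`; see `deRham_algebraMap`, `deRham_ofD` and `deRham_mul`. -/
def deRham : Forms k B →ₗ[k] Forms k B where
  toFun a := (Jet.taylor a).snd
  map_add' a b := by rw [map_add, Jet.add_snd]
  map_smul' c a := by
    rw [← algebraMap_smul B c a, map_smul, algebraMap_smul B c, Jet.base_smul, RingHom.id_apply]

variable {k B}

theorem deRham_algebraMap (b : B) : deRham k B (algebraMap B _ b) = Forms.ofD k B b := by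
  change (Jet.taylor (algebraMap B _ b)).snd = _
  rw [AlgHom.commutes]; rfl

theorem deRham_ofD (b : B) : deRham k B (Forms.ofD k B b) = 0 := by
  change (Jet.taylor (Forms.ofD k B b)).snd = _
  rw [Forms.ofD, Jet.taylor_ι, Jet.ofOneForm_D]

theorem deRham_mul (a b : Forms k B) :
    deRham k B (a * b) = deRham k B a * b + Forms.sign k B a * deRham k B b := by
  change (Jet.taylor (a * b)).snd = _
  rw [map_mul, Jet.mul_snd, Jet.taylor_fst, Jet.taylor_fst]; rfl

end DeRham

/-! ## Affine supervarieties -/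

section Super

variable {k : Type u} [Field k]

/-- A `ℤ/2`-graded algebra is supercommutative: `ab = (-1)^{|a||b|} ba` for homogeneous `a, b`. -/
class SuperCommutative {A : Type v} [Ring A] [Algebra k A] (𝒜 : ZMod 2 → Submodule k A) :
    Prop where
  even_comm : ∀ a ∈ 𝒜 0, ∀ b, a * b = b * a
  odd_anticomm : ∀ a ∈ 𝒜 1, ∀ b ∈ 𝒜 1, a * b = -(b * a)

/-- An algebra homomorphism between `ℤ/2`-graded algebras preserves parity. -/
def IsEven {A B : Type v} [Ring A] [Algebra k A] [Ring B] [Algebra k B]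
    (𝒜 : ZMod 2 → Submodule k A) (ℬ : ZMod 2 → Submodule k B) (f : A →ₐ[k] B) : Prop :=
  ∀ i, ∀ a ∈ 𝒜 i, f a ∈ ℬ i

/-- `Spec A` is a smooth affine supervariety: `A` is a finitely generated superalgebra with the
infinitesimal lifting property, i.e. for every surjection `π : B → C` of supercommutative
superalgebras with nilpotent kernel, every morphism `A → C` lifts to a morphism `A → B`. -/
structure IsSmoothAffine {A : Type v} [Ring A] [Algebra k A] (𝒜 : ZMod 2 → Submodule k A) :
    Prop where
  finiteType : Algebra.FiniteType k A
  exists_lift : ∀ (B C : Type v) [Ring B] [Algebra k B] [Ring C] [Algebra k C]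
    (ℬ : ZMod 2 → Submodule k B) (𝒞 : ZMod 2 → Submodule k C)
    [GradedAlgebra ℬ] [GradedAlgebra 𝒞] [SuperCommutative ℬ] [SuperCommutative 𝒞]
    (π : B →ₐ[k] C), IsEven ℬ 𝒞 π → Function.Surjective π →
    IsNilpotent (LinearMap.ker π.toLinearMap) →
    ∀ f : A →ₐ[k] C, IsEven 𝒜 𝒞 f → ∃ g : A →ₐ[k] B, IsEven 𝒜 ℬ g ∧ π.comp g = f

variable {A : Type v} [Ring A] [Algebra k A] (𝒜 : ZMod 2 → Submodule k A)

/-- The ideal generated by the odd functions. -/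
def oddIdeal : Ideal A := Ideal.span (𝒜 1 : Set A)

theorem exists_even_add_odd [GradedAlgebra 𝒜] (a : A) : ∃ a₀ ∈ 𝒜 0, ∃ a₁ ∈ 𝒜 1, a = a₀ + a₁ := by
  induction a using DirectSum.Decomposition.inductionOn 𝒜 with
  | zero => exact ⟨0, zero_mem _, 0, zero_mem _, by simp⟩
  | homogeneous m =>
    rename_i i
    fin_cases i
    · exact ⟨m, m.2, 0, zero_mem _, by simp⟩
    · exact ⟨0, zero_mem _, m, m.2, by simp⟩
  | add a b ha hb =>
    obtain ⟨a₀, ha₀, a₁, ha₁, rfl⟩ := ha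
    obtain ⟨b₀, hb₀, b₁, hb₁, rfl⟩ := hb
    exact ⟨a₀ + b₀, add_mem ha₀ hb₀, a₁ + b₁, add_mem ha₁ hb₁, by abel⟩

variable [GradedAlgebra 𝒜] [SuperCommutative 𝒜]

instance : (oddIdeal 𝒜).IsTwoSided where
  mul_mem_of_left {a} r ha := by
    induction ha using Submodule.span_induction with
    | mem x hx =>
      obtain ⟨r₀, hr₀, r₁, hr₁, rfl⟩ := exists_even_add_odd 𝒜 r
      rw [mul_add, ← SuperCommutative.even_comm r₀ hr₀, SuperCommutative.odd_anticomm x hx r₁ hr₁]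
      have hx' : x ∈ oddIdeal 𝒜 := Ideal.subset_span hx
      exact add_mem (Ideal.mul_mem_left _ _ hx') (neg_mem (Ideal.mul_mem_left _ _ hx'))
    | zero => simp
    | add x y _ _ hx hy => rw [add_mul]; exact add_mem hx hy
    | smul c x _ hx => rw [smul_eq_mul, mul_assoc]; exact Ideal.mul_mem_left _ _ hx

/-- The algebra of functions `k[X₀]` on the underlying even scheme `X₀` of `X = Spec A`: the
quotient of `A` by the ideal generated by the odd functions. -/
def EvenQuotient : Type v := A ⧸ oddIdeal 𝒜

instance : Ring (EvenQuotient 𝒜) := inferInstanceAs (Ring (A ⧸ oddIdeal 𝒜))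

instance : Algebra k (EvenQuotient 𝒜) := inferInstanceAs (Algebra k (A ⧸ oddIdeal 𝒜))

instance : CommRing (EvenQuotient 𝒜) where
  __ := (inferInstance : Ring (EvenQuotient 𝒜))
  mul_comm := by
    have key : ∀ a b : A, a * b - b * a ∈ oddIdeal 𝒜 := by
      intro a b
      obtain ⟨a₀, ha₀, a₁, ha₁, rfl⟩ := exists_even_add_odd 𝒜 a
      rw [add_mul, mul_add, SuperCommutative.even_comm a₀ ha₀, add_sub_add_left_eq_sub]
      have h : a₁ ∈ oddIdeal 𝒜 := Ideal.subset_span ha₁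
      exact sub_mem (Ideal.mul_mem_right _ _ h) (Ideal.mul_mem_left _ _ h)
    intro x y
    obtain ⟨a, rfl⟩ := Ideal.Quotient.mk_surjective (I := oddIdeal 𝒜) x
    obtain ⟨b, rfl⟩ := Ideal.Quotient.mk_surjective (I := oddIdeal 𝒜) y
    exact (Ideal.Quotient.eq (I := oddIdeal 𝒜)).2 (key a b)

/-- A `k`-point kills the odd functions. -/
theorem point_odd [CharZero k] (x : A →ₐ[k] k) (a : A) (ha : a ∈ 𝒜 1) : x a = 0 := by
  have h := congrArg x (SuperCommutative.odd_anticomm (𝒜 := 𝒜) a ha a ha)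
  rw [map_neg, map_mul] at h
  exact mul_self_eq_zero.1 (self_eq_neg.1 h)

end Super

/-! ## Cotangent spaces and odd vector fields -/

section VectorField

variable {k : Type u} [Field k] {A : Type v} [Ring A] [Algebra k A]

/-- The maximal ideal `𝔪ₓ` of functions vanishing at the `k`-point `x : A → k`. -/
def maxIdeal (x : A →ₐ[k] k) : Submodule k A := LinearMap.ker x.toLinearMap

/-- The cotangent space `Tₓ^*X = 𝔪ₓ/𝔪ₓ²`. -/
abbrev Cotangent (x : A →ₐ[k] k) : Type v :=
  maxIdeal x ⧸ (maxIdeal x * maxIdeal x).comap (maxIdeal x).subtype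

/-- The even (`i = 0`) and odd (`i = 1`) part of the cotangent space. -/
def cotangentPart (𝒜 : ZMod 2 → Submodule k A) (x : A →ₐ[k] k) (i : ZMod 2) :
    Submodule k (Cotangent x) :=
  ((𝒜 i).comap (maxIdeal x).subtype).map (Submodule.mkQ _)

/-- An odd vector field on `Spec A`: an odd `k`-linear map `u` with
`u(ab) = u(a)b + (-1)^{|a|} a u(b)` for homogeneous `a`. -/
structure OddVectorField (𝒜 : ZMod 2 → Submodule k A) where
  toLinearMap : A →ₗ[k] A
  odd : ∀ i, ∀ a ∈ 𝒜 i, toLinearMap a ∈ 𝒜 (i + 1)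
  leibniz_even : ∀ a ∈ 𝒜 0, ∀ b, toLinearMap (a * b) = toLinearMap a * b + a * toLinearMap b
  leibniz_odd : ∀ a ∈ 𝒜 1, ∀ b, toLinearMap (a * b) = toLinearMap a * b - a * toLinearMap b

namespace OddVectorField

variable {𝒜 : ZMod 2 → Submodule k A} (u : OddVectorField 𝒜)

/-- `u` is homological: its square acts semisimply on the algebra of functions. -/
def IsHomological : Prop :=
  Module.End.IsSemisimple (R := k) (M := A) (u.toLinearMap ∘ₗ u.toLinearMap)

/-- `u` vanishes at the point `x`: its value at `x`, the tangent vector `f ↦ u(f)(x)`, is zero. -/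
def VanishesAt (x : A →ₐ[k] k) : Prop := ∀ f, x (u.toLinearMap f) = 0

variable [CharZero k] [GradedAlgebra 𝒜] [SuperCommutative 𝒜] {u}

theorem map_sq_le {x : A →ₐ[k] k} (hx : u.VanishesAt x) :
    ∀ a ∈ maxIdeal x * maxIdeal x, u.toLinearMap a ∈ maxIdeal x * maxIdeal x := by
  intro a ha
  induction ha using Submodule.mul_induction_on' with
  | mem_mul_mem a ha b hb =>
    obtain ⟨a₀, ha₀, a₁, ha₁, rfl⟩ := exists_even_add_odd 𝒜 a
    have h₁ : a₁ ∈ maxIdeal x := point_odd 𝒜 x a₁ ha₁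
    have h₀ : a₀ ∈ maxIdeal x := by simpa using sub_mem ha h₁
    rw [add_mul, map_add, u.leibniz_even a₀ ha₀, u.leibniz_odd a₁ ha₁]
    exact add_mem (add_mem (Submodule.mul_mem_mul (hx a₀) hb) (Submodule.mul_mem_mul h₀ (hx b)))
      (sub_mem (Submodule.mul_mem_mul (hx a₁) hb) (Submodule.mul_mem_mul h₁ (hx b)))
  | add a _ b _ ha hb => rw [map_add]; exact add_mem ha hb

/-- The linear map induced on `Tₓ^*X` by an odd vector field that vanishes at `x`. -/
def cotangentMap {x : A →ₐ[k] k} (hx : u.VanishesAt x) : Cotangent x →ₗ[k] Cotangent x :=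
  Submodule.mapQ _ _ (u.toLinearMap.restrict (p := maxIdeal x) (q := maxIdeal x) fun a _ => hx a)
    fun a ha => map_sq_le hx a.1 ha

end OddVectorField

end VectorField

end SuperGeom

end

/-!
Let `J` be the ideal of odd functions of `A` and `B = A/J`. Smoothness lifts `A → A/J` along the
nilpotent extension `A₀ → A/J` of purely even algebras, so that `X` retracts onto `X₀` and `A` is
a `B`-algebra (`exists_section`); it is a finite `B`-module and `J` is nilpotent. As `u` restricts
to a derivation `B → A`, the rule `b ↦ b`, `db ↦ u(b)` defines a homomorphism `ψ : Ω^•_B → A` of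
`B`-algebras (`formsMap`), and the theorem says that `ψ` is bijective and that `ψ d = u ψ`.

*Compatibility with differentials.* On generators `ψ d = u ψ` amounts to `u² = 0`. Because `u`
vanishes at `x` and kills the odd cotangent vectors, the derivation `u²` maps `𝔪ₓ^j` to
`𝔪ₓ^(j+1)`. A semisimple endomorphism is bijective on a complement `W` of its kernel, so `W =
u²(W)` lies in all powers of all `𝔪ₓ`, and Krull's intersection theorem over `B` gives `W = 0`
(`IsRetract.sq_eq_zero`).

*Surjectivity.* At each point the odd cotangent space is the image under `u` of the even one, so
Nakayama's lemma over `B` shows that `J` is spanned modulo `J²` by the `u(b)`; since `J` is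
nilpotent, `ψ` is onto (`formsMap_surjective`).

*Injectivity.* The kernel of `ψ` lies in the nilpotent ideal of forms of positive degree, so
smoothness provides a right inverse `g` of `ψ`, and `1 - gψ` is a projection onto the kernel. It
acts on forms of degree one by an idempotent endomorphism `q` of `Ω_B`, whose image vanishes at
every closed point by injectivity of `u` on the even cotangent spaces. As the image of `q` is a
direct summand, Nakayama's lemma gives `q = 0`; then `1 - gψ` raises the order filtration of
`Ω^•_B`, and being idempotent it is zero (`formsMap_injective_of_rightInverse`).
-/

set_option linter.unusedSectionVars false

noncomputable section

namespace SuperGeom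

/-! ### Supercommutative algebras -/

section Anticommuting

variable (R : Type*) {A : Type*} [CommRing R] [Ring A] [Algebra R A]

theorem commute_span_of_anticomm {S T : Set A} (h : ∀ a ∈ S, ∀ b ∈ T, a * b = -(b * a)) :
    Commute (Submodule.span R S) (Submodule.span R T) := by
  change _ * _ = _ * _
  rw [Submodule.span_mul_span, Submodule.span_mul_span]
  apply le_antisymm <;> rw [Submodule.span_le] <;> rintro _ ⟨a, ha, b, hb, rfl⟩
  · simp only [h a ha b hb]
    exact neg_mem (Submodule.subset_span ⟨b, hb, a, ha, rfl⟩)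
  · simp only [← neg_eq_iff_eq_neg.2 (h b hb a ha)]
    exact neg_mem (Submodule.subset_span ⟨b, hb, a, ha, rfl⟩)

theorem isNilpotent_span_of_anticomm {S : Set A} (hS : S.Finite)
    (h : ∀ a ∈ S, ∀ b ∈ S, a * b = -(b * a)) (h0 : ∀ a ∈ S, a * a = 0) :
    IsNilpotent (Submodule.span R S) := by
  induction S, hS using Set.Finite.induction_on with
  | empty => rw [Submodule.span_empty]; exact IsNilpotent.zero
  | @insert a T _ _ ih =>
    rw [Submodule.span_insert, ← Submodule.add_eq_sup]
    refine Commute.isNilpotent_add (commute_span_of_anticomm R ?_) ⟨2, ?_⟩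
      (ih (fun x hx y hy => h x (Or.inr hx) y (Or.inr hy)) fun x hx => h0 x (Or.inr hx))
    · rintro _ rfl b hb
      exact h _ (Or.inl rfl) b (Or.inr hb)
    · rw [pow_two, Submodule.span_mul_span, Set.singleton_mul_singleton, h0 a (Or.inl rfl)]
      simp

/-- The `R`-submodule `A * S` has the same elements as the left ideal generated by `S`. -/
theorem mem_top_mul_span_iff {S : Set A} {a : A} :
    a ∈ (⊤ * Submodule.span R S : Submodule R A) ↔ a ∈ Ideal.span S := by
  constructor
  · intro ha
    induction ha using Submodule.mul_induction_on' with
    | mem_mul_mem x _ y hy =>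
      refine Ideal.mul_mem_left _ _ ?_
      have : Submodule.span R S ≤ (Ideal.span S).restrictScalars R :=
        Submodule.span_le.2 Ideal.subset_span
      exact this hy
    | add x _ y _ hx hy => exact add_mem hx hy
  · intro ha
    induction ha using Submodule.span_induction with
    | mem x hx =>
      rw [← one_mul x]
      exact Submodule.mul_mem_mul trivial (Submodule.subset_span hx)
    | zero => exact zero_mem _
    | add x y _ _ hx hy => exact add_mem hx hy
    | smul c x _ hx =>
      have h := Submodule.mul_mem_mul (Submodule.mem_top (R := R) (x := c)) hx
      rw [← mul_assoc] at h
      have hle : (⊤ * ⊤ : Submodule R A) * Submodule.span R S ≤ ⊤ * Submodule.span R S :=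
        mul_le_mul' le_top le_rfl
      exact hle h

end Anticommuting

section Super

variable {k : Type u} [Field k] {A : Type v} [Ring A] [Algebra k A]
  (𝒜 : ZMod 2 → Submodule k A)

theorem zmod_cases (i : ZMod 2) : i = 0 ∨ i = 1 := by
  fin_cases i
  · exact Or.inl rfl
  · exact Or.inr rfl

theorem mul_self_of_odd [CharZero k] [SuperCommutative 𝒜] {a : A} (ha : a ∈ 𝒜 1) : a * a = 0 := by
  have h := SuperCommutative.odd_anticomm (𝒜 := 𝒜) a ha a ha
  have h2 : (2 : k) • (a * a) = 0 := by
    rw [two_smul]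
    nth_rewrite 1 [h]
    exact neg_add_cancel _
  exact (smul_eq_zero.1 h2).resolve_left two_ne_zero

theorem isNilpotent_span_odd [CharZero k] [SuperCommutative 𝒜] (R : Type*) [CommRing R]
    [Algebra R A] {S : Set A} (hf : S.Finite) (hS : S ⊆ 𝒜 1) :
    IsNilpotent (Submodule.span R S) :=
  isNilpotent_span_of_anticomm R hf
    (fun a ha b hb => SuperCommutative.odd_anticomm a (hS ha) b (hS hb))
    fun _ ha => mul_self_of_odd 𝒜 (hS ha)

variable [GradedAlgebra 𝒜]

theorem mul_mem_of_even_even {a b : A} (ha : a ∈ 𝒜 0) (hb : b ∈ 𝒜 0) : a * b ∈ 𝒜 0 := by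
  simpa using SetLike.GradedMul.mul_mem (A := 𝒜) ha hb

theorem mul_mem_of_even_odd {a b : A} (ha : a ∈ 𝒜 0) (hb : b ∈ 𝒜 1) : a * b ∈ 𝒜 1 := by
  simpa using SetLike.GradedMul.mul_mem (A := 𝒜) ha hb

theorem mul_mem_of_odd_odd {a b : A} (ha : a ∈ 𝒜 1) (hb : b ∈ 𝒜 1) : a * b ∈ 𝒜 0 := by
  have h := SetLike.GradedMul.mul_mem (A := 𝒜) ha hb
  rwa [show (1 : ZMod 2) + 1 = 0 from rfl] at h

theorem eq_zero_of_even_of_odd {a : A} (h0 : a ∈ 𝒜 0) (h1 : a ∈ 𝒜 1) : a = 0 := by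
  by_contra h
  have := DirectSum.degree_eq_of_mem_mem 𝒜 h0 h1 h
  exact absurd this (by decide)

theorem even_odd_unique {a₀ b₀ a₁ b₁ : A} (ha₀ : a₀ ∈ 𝒜 0) (hb₀ : b₀ ∈ 𝒜 0) (ha₁ : a₁ ∈ 𝒜 1)
    (hb₁ : b₁ ∈ 𝒜 1) (h : a₀ + a₁ = b₀ + b₁) : a₀ = b₀ ∧ a₁ = b₁ := by
  have h' : a₀ - b₀ = b₁ - a₁ := by
    rw [sub_eq_sub_iff_add_eq_add, h, add_comm]
  have : a₀ - b₀ = 0 :=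
    eq_zero_of_even_of_odd 𝒜 (sub_mem ha₀ hb₀) (h' ▸ sub_mem hb₁ ha₁)
  refine ⟨sub_eq_zero.1 this, ?_⟩
  rw [this] at h'
  exact (sub_eq_zero.1 h'.symm).symm

variable [SuperCommutative 𝒜]

variable (R : Type*) [CommRing R] [Algebra R A]

theorem commute_top_span_odd {S : Set A} (hS : S ⊆ 𝒜 1) :
    Commute (⊤ : Submodule R A) (Submodule.span R S) := by
  change _ * _ = _ * _
  rw [← Submodule.span_univ, Submodule.span_mul_span, Submodule.span_mul_span]
  apply le_antisymm <;> rw [Submodule.span_le]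
  · rintro _ ⟨a, -, b, hb, rfl⟩
    obtain ⟨a₀, ha₀, a₁, ha₁, rfl⟩ := exists_even_add_odd 𝒜 a
    simp only [add_mul]
    rw [SuperCommutative.even_comm a₀ ha₀, SuperCommutative.odd_anticomm a₁ ha₁ b (hS hb)]
    exact add_mem (Submodule.subset_span ⟨b, hb, a₀, trivial, rfl⟩)
      (neg_mem (Submodule.subset_span ⟨b, hb, a₁, trivial, rfl⟩))
  · rintro _ ⟨b, hb, a, -, rfl⟩
    obtain ⟨a₀, ha₀, a₁, ha₁, rfl⟩ := exists_even_add_odd 𝒜 a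
    simp only [mul_add]
    rw [← SuperCommutative.even_comm a₀ ha₀, SuperCommutative.odd_anticomm b (hS hb) a₁ ha₁]
    exact add_mem (Submodule.subset_span ⟨a₀, trivial, b, hb, rfl⟩)
      (neg_mem (Submodule.subset_span ⟨a₁, trivial, b, hb, rfl⟩))

theorem isNilpotent_top_mul_span_odd [CharZero k] {S : Set A} (hf : S.Finite) (hS : S ⊆ 𝒜 1) :
    IsNilpotent (⊤ * Submodule.span R S : Submodule R A) :=
  (commute_top_span_odd 𝒜 R hS).isNilpotent_mul_left (isNilpotent_span_odd 𝒜 R hf hS)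

/-- In a finitely generated superalgebra the ideal of odd functions is generated by finitely many
odd functions. -/
theorem exists_finite_span_eq_oddIdeal [Algebra.FiniteType k A] :
    ∃ S : Set A, S.Finite ∧ S ⊆ 𝒜 1 ∧ oddIdeal 𝒜 = Ideal.span S := by
  obtain ⟨G, hG⟩ := (Algebra.FiniteType.out : (⊤ : Subalgebra k A).FG)
  choose e he o ho heo using exists_even_add_odd 𝒜
  refine ⟨o '' G, G.finite_toSet.image o, ?_, ?_⟩
  · rintro _ ⟨a, -, rfl⟩
    exact ho a
  have key : ∀ a : A, ∃ a₀ ∈ 𝒜 0, ∃ a₁ ∈ 𝒜 1, a₁ ∈ Ideal.span (o '' (G : Set A)) ∧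
      a = a₀ + a₁ := by
    intro a
    have ha : a ∈ Algebra.adjoin k (G : Set A) := hG ▸ Algebra.mem_top
    induction ha using Algebra.adjoin_induction with
    | mem x hx => exact ⟨e x, he x, o x, ho x, Ideal.subset_span ⟨x, hx, rfl⟩, heo x⟩
    | algebraMap r =>
      exact ⟨_, SetLike.algebraMap_mem_graded 𝒜 r, 0, zero_mem _, zero_mem _, by simp⟩
    | add x y _ _ hx hy =>
      obtain ⟨x₀, hx₀, x₁, hx₁, hx, rfl⟩ := hx
      obtain ⟨y₀, hy₀, y₁, hy₁, hy, rfl⟩ := hy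
      exact ⟨_, add_mem hx₀ hy₀, _, add_mem hx₁ hy₁, add_mem hx hy, by abel⟩
    | mul x y _ _ hx hy =>
      obtain ⟨x₀, hx₀, x₁, hx₁, hx, rfl⟩ := hx
      obtain ⟨y₀, hy₀, y₁, hy₁, hy, rfl⟩ := hy
      refine ⟨x₀ * y₀ + x₁ * y₁,
        add_mem (mul_mem_of_even_even 𝒜 hx₀ hy₀) (mul_mem_of_odd_odd 𝒜 hx₁ hy₁),
        x₀ * y₁ + y₀ * x₁,
        add_mem (mul_mem_of_even_odd 𝒜 hx₀ hy₁) (mul_mem_of_even_odd 𝒜 hy₀ hx₁),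
        add_mem (Ideal.mul_mem_left _ _ hy) (Ideal.mul_mem_left _ _ hx), ?_⟩
      rw [SuperCommutative.even_comm y₀ hy₀ x₁]
      noncomm_ring
  apply le_antisymm
  · refine Ideal.span_le.2 fun a ha => ?_
    obtain ⟨a₀, ha₀, a₁, ha₁, hmem, heq⟩ := key a
    have := (even_odd_unique 𝒜 (zero_mem _) ha₀ ha ha₁ (by rw [zero_add]; exact heq)).2
    rw [this]
    exact hmem
  · refine Ideal.span_mono ?_
    rintro _ ⟨a, -, rfl⟩
    exact ho a

end Super

/-! ### Closed points of the base -/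

section Points

variable {k : Type u} [Field k] [IsAlgClosed k] {B : Type v} [CommRing B] [Algebra k B]
  [Algebra.FiniteType k B]

/-- The Nullstellensatz: maximal ideals are the kernels of `k`-points. -/
theorem exists_point (n : Ideal B) [n.IsMaximal] :
    ∃ y : B →ₐ[k] k, RingHom.ker y = n := by
  let : Field (B ⧸ n) := Ideal.Quotient.field n
  have : Algebra.FiniteType k (B ⧸ n) :=
    Algebra.FiniteType.of_surjective (Ideal.Quotient.mkₐ k n) (Ideal.Quotient.mkₐ_surjective k n)
  have : Module.Finite k (B ⧸ n) := finite_of_finite_type_of_isJacobsonRing k (B ⧸ n)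
  have hb := IsAlgClosed.algebraMap_bijective_of_isIntegral (k := k) (K := B ⧸ n)
  let e : k ≃ₐ[k] (B ⧸ n) := AlgEquiv.ofBijective (Algebra.ofId k (B ⧸ n)) hb
  refine ⟨(e.symm : (B ⧸ n) →ₐ[k] k).comp (Ideal.Quotient.mkₐ k n), ?_⟩
  ext b
  rw [RingHom.mem_ker]
  change e.symm (Ideal.Quotient.mk n b) = 0 ↔ _
  rw [map_eq_zero_iff _ e.symm.injective, Ideal.Quotient.eq_zero_iff_mem]

/-- An element of a module vanishes if at every closed point it is killed by a function that does
not vanish there. -/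
theorem eq_zero_of_forall_point {M : Type*} [AddCommGroup M] [Module B M] (x : M)
    (h : ∀ y : B →ₐ[k] k, ∃ r : B, y r ≠ 0 ∧ r • x = 0) : x = 0 := by
  by_contra hx
  have hne : LinearMap.ker (LinearMap.toSpanSingleton B M x) ≠ ⊤ := by
    intro htop
    have : (1 : B) ∈ LinearMap.ker (LinearMap.toSpanSingleton B M x) := htop ▸ trivial
    rw [LinearMap.mem_ker, LinearMap.toSpanSingleton_apply, one_smul] at this
    exact hx this
  obtain ⟨n, hn, hle⟩ := Ideal.exists_le_maximal _ hne
  obtain ⟨y, hy⟩ := exists_point (k := k) n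
  obtain ⟨r, hr, hrx⟩ := h y
  have : r ∈ RingHom.ker y := hy ▸ hle (by simpa using hrx)
  exact hr this

/-- Nakayama's lemma over all closed points. -/
theorem eq_bot_of_forall_point {M : Type*} [AddCommGroup M] [Module B M] (N : Submodule B M)
    (hN : N.FG) (h : ∀ y : B →ₐ[k] k, N ≤ (RingHom.ker y : Ideal B) • N) : N = ⊥ := by
  refine (Submodule.eq_bot_iff _).2 fun x hx =>
    eq_zero_of_forall_point (k := k) (B := B) x fun y => ?_
  obtain ⟨r, hr, hr'⟩ :=
    Submodule.exists_sub_one_mem_and_smul_eq_zero_of_fg_of_le_smul _ N hN (h y)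
  refine ⟨r, ?_, hr' x hx⟩
  rw [RingHom.mem_ker, map_sub, map_one, sub_eq_zero] at hr
  rw [hr]
  exact one_ne_zero

/-- Krull's intersection theorem over all closed points. -/
theorem eq_zero_of_forall_mem_pow_smul {M : Type*} [AddCommGroup M] [Module B M]
    [Module.Finite B M] (x : M) (h : ∀ (y : B →ₐ[k] k) (i : ℕ),
      x ∈ ((RingHom.ker y : Ideal B) ^ i • ⊤ : Submodule B M)) : x = 0 := by
  have : IsNoetherianRing B := Algebra.FiniteType.isNoetherianRing k B
  refine eq_zero_of_forall_point (k := k) (B := B) x fun y => ?_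
  obtain ⟨r, hr⟩ := (Ideal.mem_iInf_smul_pow_eq_bot_iff (RingHom.ker y) x).1
    (Submodule.mem_iInf _ |>.2 (h y))
  refine ⟨1 - r, ?_, by rw [sub_smul, one_smul, hr, sub_self]⟩
  have : y r = 0 := r.2
  rw [map_sub, this, map_one, sub_zero]
  exact one_ne_zero

end Points

/-! ### Supervarieties retracting to the even part -/

section Retract

variable {k : Type u} [Field k] {B : Type v} [CommRing B] [Algebra k B]
  {A : Type v} [Ring A] [Algebra k A] [Algebra B A] [IsScalarTower k B A]

/-- The homomorphism `π : A → B` of `B`-algebras exhibits `Spec B` as the underlying even scheme of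
`Spec A`, and the structure map `B → A` as a retraction `Spec A → Spec B`. -/
structure IsRetract (𝒜 : ZMod 2 → Submodule k A) (π : A →ₐ[B] B) : Prop where
  eq_zero_iff : ∀ a, π a = 0 ↔ a ∈ oddIdeal 𝒜
  algebraMap_mem : ∀ b, algebraMap B A b ∈ 𝒜 0

/-- The `k`-point of `Spec A` defined by a `k`-point of `Spec B`. -/
def liftPoint (π : A →ₐ[B] B) (y : B →ₐ[k] k) : A →ₐ[k] k := y.comp (π.restrictScalars k)

theorem mem_maxIdeal_liftPoint {π : A →ₐ[B] B} {y : B →ₐ[k] k} {a : A} :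
    a ∈ maxIdeal (liftPoint π y) ↔ y (π a) = 0 := Iff.rfl

/-- The ideal of the closed subscheme `Spec B` of `Spec A`. -/
abbrev augIdeal (π : A →ₐ[B] B) : Submodule B A := LinearMap.ker π.toLinearMap

theorem mem_augIdeal {π : A →ₐ[B] B} {a : A} : a ∈ augIdeal π ↔ π a = 0 := Iff.rfl

theorem sub_mem_augIdeal (π : A →ₐ[B] B) (a : A) : a - algebraMap B A (π a) ∈ augIdeal π := by
  rw [mem_augIdeal, map_sub, AlgHom.commutes]
  exact sub_self _

theorem augIdeal_le_maxIdeal (π : A →ₐ[B] B) (y : B →ₐ[k] k) :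
    (augIdeal π).restrictScalars k ≤ maxIdeal (liftPoint π y) := fun a ha => by
  rw [mem_maxIdeal_liftPoint, show π a = 0 from ha, map_zero]

theorem augIdeal_mul_le_maxIdeal_mul (π : A →ₐ[B] B) (y : B →ₐ[k] k) :
    (augIdeal π * augIdeal π).restrictScalars k ≤
      maxIdeal (liftPoint π y) * maxIdeal (liftPoint π y) := fun a ha => by
  replace ha : a ∈ augIdeal π * augIdeal π := ha
  induction ha using Submodule.mul_induction_on' with
  | mem_mul_mem a ha b hb =>
    exact Submodule.mul_mem_mul (augIdeal_le_maxIdeal π y ha) (augIdeal_le_maxIdeal π y hb)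
  | add a _ b _ ha hb => exact add_mem ha hb

theorem algebraMap_mem_maxIdeal (π : A →ₐ[B] B) (y : B →ₐ[k] k) {b : B} (hb : y b = 0) :
    algebraMap B A b ∈ maxIdeal (liftPoint π y) := by
  rw [mem_maxIdeal_liftPoint, AlgHom.commutes]
  exact hb

theorem smul_mem_maxIdeal_mul (π : A →ₐ[B] B) (y : B →ₐ[k] k) {b : B} (hb : y b = 0) {a : A}
    (ha : a ∈ maxIdeal (liftPoint π y)) :
    b • a ∈ maxIdeal (liftPoint π y) * maxIdeal (liftPoint π y) := by
  rw [Algebra.smul_def]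
  exact Submodule.mul_mem_mul (algebraMap_mem_maxIdeal π y hb) ha

/-- The components of an element of `𝔪ₓ²` along the splitting `A = B ⊕ J`. -/
theorem of_mem_maxIdeal_mul (π : A →ₐ[B] B) (y : B →ₐ[k] k) {a : A}
    (ha : a ∈ maxIdeal (liftPoint π y) * maxIdeal (liftPoint π y)) :
    π a ∈ (RingHom.ker y : Ideal B) ^ 2 ∧
      a - algebraMap B A (π a) ∈
        (RingHom.ker y : Ideal B) • augIdeal π ⊔ augIdeal π * augIdeal π := by
  induction ha using Submodule.mul_induction_on' with
  | mem_mul_mem a ha b hb =>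
    have ha' : π a ∈ (RingHom.ker y : Ideal B) := ha
    have hb' : π b ∈ (RingHom.ker y : Ideal B) := hb
    refine ⟨by rw [map_mul, pow_two]; exact Ideal.mul_mem_mul ha' hb', ?_⟩
    have key : a * b - algebraMap B A (π (a * b)) =
        π a • (b - algebraMap B A (π b)) + π b • (a - algebraMap B A (π a)) +
          (a - algebraMap B A (π a)) * (b - algebraMap B A (π b)) := by
      rw [map_mul, map_mul, Algebra.smul_def, Algebra.smul_def, sub_mul a, mul_sub a,
        ← Algebra.commutes (π b) a, Algebra.commutes (π a) (algebraMap B A (π b))]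
      noncomm_ring
    rw [key]
    exact add_mem (Submodule.mem_sup_left (add_mem
      (Submodule.smul_mem_smul ha' (sub_mem_augIdeal π b))
      (Submodule.smul_mem_smul hb' (sub_mem_augIdeal π a))))
      (Submodule.mem_sup_right (Submodule.mul_mem_mul (sub_mem_augIdeal π a)
        (sub_mem_augIdeal π b)))
  | add a _ b _ ha hb =>
    refine ⟨by rw [map_add]; exact add_mem ha.1 hb.1, ?_⟩
    rw [map_add, map_add, add_sub_add_comm]
    exact add_mem ha.2 hb.2

theorem mul_mem_smul_top {I I' : Ideal B} {a b : A} (ha : a ∈ (I • ⊤ : Submodule B A))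
    (hb : b ∈ (I' • ⊤ : Submodule B A)) : a * b ∈ ((I * I') • ⊤ : Submodule B A) := by
  induction ha using Submodule.smul_induction_on' with
  | smul r hr m _ =>
    induction hb using Submodule.smul_induction_on' with
    | smul r' hr' m' _ =>
      rw [smul_mul_smul_comm]
      exact Submodule.smul_mem_smul (Ideal.mul_mem_mul hr hr') trivial
    | add x _ y _ hx hy => rw [mul_add]; exact add_mem hx hy
  | add x _ y _ hx hy => rw [add_mul]; exact add_mem hx hy

theorem mul_mem_smul_top_left {I : Ideal B} {a : A} (ha : a ∈ (I • ⊤ : Submodule B A)) (b : A) :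
    a * b ∈ (I • ⊤ : Submodule B A) := by
  have := mul_mem_smul_top (I' := ⊤) ha (b := b) (by simp)
  rwa [Ideal.mul_top] at this

theorem maxIdeal_pow_le (π : A →ₐ[B] B) (y : B →ₐ[k] k) (j : ℕ) :
    maxIdeal (liftPoint π y) ^ j ≤
      ((RingHom.ker y : Ideal B) • ⊤ ⊔ augIdeal π ^ j).restrictScalars k := by
  induction j with
  | zero =>
    intro a ha
    rw [pow_zero] at ha ⊢
    refine Submodule.mem_sup_right ?_
    obtain ⟨c, rfl⟩ := Submodule.mem_one.1 ha
    rw [IsScalarTower.algebraMap_apply k B A]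
    exact Submodule.mem_one.2 ⟨_, rfl⟩
  | succ j ih =>
    rw [pow_succ]
    refine (mul_le_mul' ih le_rfl).trans (Submodule.mul_le.2 ?_)
    intro a ha b hb
    obtain ⟨a₁, ha₁, a₂, ha₂, rfl⟩ := Submodule.mem_sup.1 ha
    rw [add_mul]
    refine add_mem (Submodule.mem_sup_left (mul_mem_smul_top_left ha₁ b)) ?_
    have hbb : b = algebraMap B A (π b) + (b - algebraMap B A (π b)) := by abel
    rw [hbb, mul_add, ← Algebra.commutes, ← Algebra.smul_def]
    refine add_mem (Submodule.mem_sup_left (Submodule.smul_mem_smul hb trivial))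
      (Submodule.mem_sup_right ?_)
    rw [pow_succ]
    exact Submodule.mul_mem_mul ha₂ (sub_mem_augIdeal π b)

theorem maxIdeal_pow_pow_le (π : A →ₐ[B] B) (hJ : IsNilpotent (augIdeal π)) (y : B →ₐ[k] k) :
    ∃ N, N ≠ 0 ∧ ∀ i, maxIdeal (liftPoint π y) ^ (N * i) ≤
      ((RingHom.ker y : Ideal B) ^ i • ⊤ : Submodule B A).restrictScalars k := by
  obtain ⟨N, hN⟩ := hJ
  refine ⟨N + 1, N.succ_ne_zero, fun i => ?_⟩
  have h1 := maxIdeal_pow_le π y (N + 1)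
  rw [pow_succ (augIdeal π), hN, zero_mul, Submodule.zero_eq_bot, sup_bot_eq] at h1
  induction i with
  | zero => intro a _; simp
  | succ i ih =>
    rw [Nat.mul_succ, pow_add]
    refine (mul_le_mul' ih h1).trans (Submodule.mul_le.2 fun a ha b hb => ?_)
    rw [pow_succ]
    exact mul_mem_smul_top ha hb

section

variable {𝒜 : ZMod 2 → Submodule k A} {π : A →ₐ[B] B}

theorem IsRetract.odd_mem (h : IsRetract 𝒜 π) {a : A} (ha : a ∈ 𝒜 1) : a ∈ augIdeal π :=
  (h.eq_zero_iff a).2 (Ideal.subset_span ha)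

variable [GradedAlgebra 𝒜] [SuperCommutative 𝒜]

/-- Even functions vanishing on `Spec B` lie in the square of its ideal. -/
theorem IsRetract.even_mem_mul (h : IsRetract 𝒜 π) {a : A} (ha : a ∈ 𝒜 0) (hπ : π a = 0) :
    a ∈ augIdeal π * augIdeal π := by
  have key : ∀ a ∈ oddIdeal 𝒜, ∃ a₀ ∈ 𝒜 0, ∃ a₁ ∈ 𝒜 1, a₀ ∈ augIdeal π * augIdeal π ∧
      a = a₀ + a₁ := by
    intro a ha
    have ha' : a ∈ (⊤ * Submodule.span k (𝒜 1 : Set A) : Submodule k A) :=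
      (mem_top_mul_span_iff k).2 ha
    rw [Submodule.span_eq] at ha'
    induction ha' using Submodule.mul_induction_on' with
    | mem_mul_mem x _ θ hθ =>
      obtain ⟨x₀, hx₀, x₁, hx₁, rfl⟩ := exists_even_add_odd 𝒜 x
      exact ⟨_, mul_mem_of_odd_odd 𝒜 hx₁ hθ, _, mul_mem_of_even_odd 𝒜 hx₀ hθ,
        Submodule.mul_mem_mul (h.odd_mem hx₁) (h.odd_mem hθ), by noncomm_ring⟩
    | add x hx y hy ihx ihy =>
      obtain ⟨x₀, hx₀, x₁, hx₁, hx', rfl⟩ := ihx ((mem_top_mul_span_iff k).1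
        (by rwa [Submodule.span_eq]))
      obtain ⟨y₀, hy₀, y₁, hy₁, hy', rfl⟩ := ihy ((mem_top_mul_span_iff k).1
        (by rwa [Submodule.span_eq]))
      exact ⟨_, add_mem hx₀ hy₀, _, add_mem hx₁ hy₁, add_mem hx' hy', by abel⟩
  obtain ⟨a₀, ha₀, a₁, ha₁, hm, heq⟩ := key a ((h.eq_zero_iff a).1 hπ)
  rw [(even_odd_unique 𝒜 ha ha₀ (zero_mem _) ha₁ (by rw [add_zero]; exact heq)).1]
  exact hm

variable [Algebra.FiniteType k A]

theorem IsRetract.exists_finite (h : IsRetract 𝒜 π) : ∃ S : Set A, S.Finite ∧ S ⊆ 𝒜 1 ∧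
    augIdeal π = ⊤ * Submodule.span B S := by
  obtain ⟨S, hf, hS, hJ⟩ := exists_finite_span_eq_oddIdeal 𝒜
  refine ⟨S, hf, hS, ?_⟩
  ext a
  rw [mem_top_mul_span_iff, ← hJ]
  exact h.eq_zero_iff a

variable [CharZero k]

theorem IsRetract.isNilpotent (h : IsRetract 𝒜 π) : IsNilpotent (augIdeal π) := by
  obtain ⟨S, hf, hS, hJ⟩ := h.exists_finite
  rw [hJ]
  exact isNilpotent_top_mul_span_odd 𝒜 B hf hS

theorem IsRetract.finite (h : IsRetract 𝒜 π) : Module.Finite B A := by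
  obtain ⟨S, hf, hS, hJ⟩ := h.exists_finite
  set N := Submodule.span B S with hN
  have hN' : N.FG := Submodule.fg_span hf
  obtain ⟨m, hm⟩ := isNilpotent_span_odd 𝒜 B hf hS
  rw [← hN] at hm
  have htop : (⊤ : Submodule B A) = 1 + ⊤ * N := by
    rw [← hJ, eq_comm, Submodule.add_eq_sup, eq_top_iff]
    intro a _
    rw [← add_sub_cancel (algebraMap B A (π a)) a]
    exact add_mem (Submodule.mem_sup_left (Submodule.mem_one.2 ⟨_, rfl⟩))
      (Submodule.mem_sup_right (sub_mem_augIdeal π a))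
  have key : ∀ j : ℕ, ∃ P : Submodule B A, P.FG ∧ (⊤ : Submodule B A) = P + ⊤ * N ^ j := by
    intro j
    induction j with
    | zero => exact ⟨⊥, Submodule.fg_bot, by simp⟩
    | succ j ih =>
      obtain ⟨P, hP, hPj⟩ := ih
      refine ⟨P + N ^ j, hP.sup (hN'.pow j), ?_⟩
      rw [pow_succ', ← mul_assoc, add_assoc, ← one_add_mul, ← htop, ← hPj]
  obtain ⟨P, hP, hPm⟩ := key m
  refine ⟨?_⟩
  rw [hPm, hm, mul_zero, add_zero]
  exact hP

theorem finiteType_base (π : A →ₐ[B] B) : Algebra.FiniteType k B :=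
  Algebra.FiniteType.of_surjective (π.restrictScalars k)
    fun b => ⟨algebraMap B A b, π.commutes b⟩

/-- Functions vanishing to infinite order at every point are zero. -/
theorem IsRetract.eq_zero_of_forall_mem_pow (h : IsRetract 𝒜 π) [IsAlgClosed k] {a : A}
    (ha : ∀ (y : B →ₐ[k] k) (j : ℕ), j ≠ 0 → a ∈ maxIdeal (liftPoint π y) ^ j) : a = 0 := by
  have : Algebra.FiniteType k B := finiteType_base π
  have := h.finite
  refine eq_zero_of_forall_mem_pow_smul (k := k) (B := B) a fun y i => ?_
  obtain ⟨N, hN0, hN⟩ := maxIdeal_pow_pow_le π h.isNilpotent y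
  rcases eq_or_ne i 0 with rfl | hi
  · simp
  · exact hN i (ha y _ (mul_ne_zero hN0 hi))

end

end Retract

/-! ### Odd vector fields near their zeros -/

section Semisimple

variable {k : Type*} [Field k] {M : Type*} [AddCommGroup M] [Module k M]

/-- A semisimple endomorphism acts bijectively on an invariant complement of its kernel. -/
theorem exists_isCompl_ker_map_eq {D : Module.End k M} (hD : D.IsSemisimple) :
    ∃ W : Submodule k M, IsCompl (LinearMap.ker D) W ∧ W.map D = W := by
  rw [Module.End.isSemisimple_iff] at hD
  obtain ⟨W, hW, hc⟩ := hD (LinearMap.ker D) fun a ha => by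
    rw [Submodule.mem_comap, LinearMap.mem_ker.1 ha]
    exact zero_mem _
  refine ⟨W, hc, ?_⟩
  have hWD : W.map D ≤ W := Submodule.map_le_iff_le_comap.2 hW
  obtain ⟨V, hV, hc'⟩ := hD (W.map D) fun a ha => Submodule.mem_map_of_mem (hWD ha)
  refine le_antisymm hWD fun w hw => ?_
  -- `w = D w' + v` with `v ∈ V ∩ W`, and `D v` lies both in `D W` and in `V`.
  obtain ⟨d, hd, v, hv, rfl⟩ := Submodule.mem_sup.1
    (hc'.sup_eq_top ▸ Submodule.mem_top : w ∈ W.map D ⊔ V)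
  have hvW : v ∈ W := by simpa using sub_mem hw (hWD hd)
  have hDv : D v = 0 := (Submodule.disjoint_def.1 hc'.disjoint) _
    (Submodule.mem_map_of_mem hvW) (hV hv)
  have : v = 0 := (Submodule.disjoint_def.1 hc.disjoint) _ hDv hvW
  rw [this, add_zero]
  exact hd

end Semisimple

section VectorField

variable {k : Type u} [Field k] {A : Type v} [Ring A] [Algebra k A]
  {𝒜 : ZMod 2 → Submodule k A} [GradedAlgebra 𝒜] [SuperCommutative 𝒜] (u : OddVectorField 𝒜)

namespace OddVectorField

variable {u}

theorem odd_of_even {a : A} (ha : a ∈ 𝒜 0) : u.toLinearMap a ∈ 𝒜 1 := by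
  have h := u.odd 0 a ha
  rwa [zero_add] at h

theorem even_of_odd {a : A} (ha : a ∈ 𝒜 1) : u.toLinearMap a ∈ 𝒜 0 := by
  have h := u.odd 1 a ha
  rwa [show (1 : ZMod 2) + 1 = 0 from rfl] at h

theorem sq_leibniz (a b : A) : u.toLinearMap (u.toLinearMap (a * b)) =
    u.toLinearMap (u.toLinearMap a) * b + a * u.toLinearMap (u.toLinearMap b) := by
  obtain ⟨a₀, ha₀, a₁, ha₁, rfl⟩ := exists_even_add_odd 𝒜 a
  simp only [add_mul, map_add]
  rw [u.leibniz_even a₀ ha₀, u.leibniz_odd a₁ ha₁, map_add, map_sub,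
    u.leibniz_odd _ (odd_of_even ha₀), u.leibniz_even _ ha₀,
    u.leibniz_even _ (even_of_odd ha₁), u.leibniz_odd _ ha₁]
  abel

variable [CharZero k] {x : A →ₐ[k] k} (hx : u.VanishesAt x)

theorem mk_mem_cotangentPart {i : ZMod 2} {a : A} (ha : a ∈ 𝒜 i) (ham : a ∈ maxIdeal x) :
    (Submodule.Quotient.mk ⟨a, ham⟩ : Cotangent x) ∈ cotangentPart 𝒜 x i :=
  ⟨⟨a, ham⟩, ha, rfl⟩

theorem cotangentMap_mk {a : A} (ham : a ∈ maxIdeal x) :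
    cotangentMap hx (Submodule.Quotient.mk ⟨a, ham⟩) =
      Submodule.Quotient.mk ⟨u.toLinearMap a, hx a⟩ := rfl

theorem cotangent_mk_eq_iff {a b : A} (ham : a ∈ maxIdeal x) (hbm : b ∈ maxIdeal x) :
    (Submodule.Quotient.mk ⟨a, ham⟩ : Cotangent x) = Submodule.Quotient.mk ⟨b, hbm⟩ ↔
      a - b ∈ maxIdeal x * maxIdeal x :=
  Submodule.Quotient.eq _

theorem apply_odd_mem (hodd : ∀ ξ ∈ cotangentPart 𝒜 x 1, cotangentMap hx ξ = 0) {a : A}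
    (ha : a ∈ 𝒜 1) : u.toLinearMap a ∈ maxIdeal x * maxIdeal x := by
  have h := hodd _ (mk_mem_cotangentPart ha (point_odd 𝒜 x a ha))
  have h' := (cotangent_mk_eq_iff (hx a) (zero_mem _)).1 h
  rwa [sub_zero] at h'

theorem exists_apply_sub_mem (heven : Set.BijOn (cotangentMap hx) (cotangentPart 𝒜 x 0)
    (cotangentPart 𝒜 x 1)) {a : A} (ha : a ∈ 𝒜 1) :
    ∃ c ∈ 𝒜 0, u.toLinearMap c - a ∈ maxIdeal x * maxIdeal x := by
  obtain ⟨_, ⟨⟨c, hcm⟩, hc, rfl⟩, h⟩ :=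
    heven.surjOn (mk_mem_cotangentPart ha (point_odd 𝒜 x a ha))
  exact ⟨c, hc, (cotangent_mk_eq_iff (hx c) (point_odd 𝒜 x a ha)).1 h⟩

theorem mem_of_apply_mem (heven : Set.BijOn (cotangentMap hx) (cotangentPart 𝒜 x 0)
    (cotangentPart 𝒜 x 1)) {a : A} (ha : a ∈ 𝒜 0) (ham : a ∈ maxIdeal x)
    (hu : u.toLinearMap a ∈ maxIdeal x * maxIdeal x) : a ∈ maxIdeal x * maxIdeal x := by
  have h := heven.injOn (mk_mem_cotangentPart ha ham) (zero_mem _) (by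
    rw [map_zero, cotangentMap_mk]
    exact (cotangent_mk_eq_iff (hx a) (zero_mem _)).2 (by rwa [sub_zero]))
  have h' := (cotangent_mk_eq_iff ham (zero_mem _)).1 h
  rwa [sub_zero] at h'

/-- `u²` raises the order of vanishing at `x`. -/
theorem sq_apply_mem_pow (hodd : ∀ ξ ∈ cotangentPart 𝒜 x 1, cotangentMap hx ξ = 0)
    (j : ℕ) : ∀ a ∈ maxIdeal x ^ j,
      u.toLinearMap (u.toLinearMap a) ∈ maxIdeal x ^ (j + 1) := by
  induction j with
  | zero => intro a _; rw [zero_add, pow_one]; exact hx _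
  | succ j ih =>
    intro a ha
    rw [pow_succ'] at ha
    induction ha using Submodule.mul_induction_on' with
    | mem_mul_mem a ha b hb =>
      rw [sq_leibniz]
      refine add_mem ?_ ?_
      · rw [show j + 1 + 1 = 2 + j by ring, pow_add, pow_two]
        refine Submodule.mul_mem_mul ?_ hb
        obtain ⟨a₀, ha₀, a₁, ha₁, rfl⟩ := exists_even_add_odd 𝒜 a
        rw [map_add, map_add]
        exact add_mem (apply_odd_mem hx hodd (odd_of_even ha₀))
          (map_sq_le hx _ (apply_odd_mem hx hodd ha₁))
      · rw [pow_succ' _ (j + 1)]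
        exact Submodule.mul_mem_mul ha (ih b hb)
    | add a _ b _ ha hb => rw [map_add, map_add]; exact add_mem ha hb

end OddVectorField

end VectorField

section Retract

variable {k : Type u} [Field k] [CharZero k] [IsAlgClosed k] {B : Type v} [CommRing B] [Algebra k B]
  {A : Type v} [Ring A] [Algebra k A] [Algebra B A] [IsScalarTower k B A]
  [Algebra.FiniteType k A]
  {𝒜 : ZMod 2 → Submodule k A} [GradedAlgebra 𝒜] [SuperCommutative 𝒜] {u : OddVectorField 𝒜}
  {π : A →ₐ[B] B}

/-- `u²` is semisimple and acts nilpotently on all finite jets, hence vanishes. -/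
theorem IsRetract.sq_eq_zero (h : IsRetract 𝒜 π) (hu : u.IsHomological)
    (hvan : ∀ x : A →ₐ[k] k, u.VanishesAt x)
    (hodd : ∀ x : A →ₐ[k] k, ∀ ξ ∈ cotangentPart 𝒜 x 1,
      OddVectorField.cotangentMap (hvan x) ξ = 0) (a : A) :
    u.toLinearMap (u.toLinearMap a) = 0 := by
  obtain ⟨W, hc, hW⟩ := exists_isCompl_ker_map_eq hu
  have hbot : W = ⊥ := by
    refine (Submodule.eq_bot_iff _).2 fun w hw => h.eq_zero_of_forall_mem_pow fun y j hj => ?_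
    suffices hle : W ≤ maxIdeal (liftPoint π y) ^ j from hle hw
    replace hj := Nat.one_le_iff_ne_zero.2 hj
    induction j, hj using Nat.le_induction with
    | base =>
      rw [pow_one, ← hW]
      rintro _ ⟨w', hw', rfl⟩
      exact hvan (liftPoint π y) _
    | succ j hj ih =>
      rw [← hW]
      rintro _ ⟨w', hw', rfl⟩
      exact OddVectorField.sq_apply_mem_pow (hvan _) (hodd _) j w' (ih hw')
  rw [hbot] at hc
  have : LinearMap.ker (u.toLinearMap ∘ₗ u.toLinearMap) = ⊤ := eq_top_of_isCompl_bot hc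
  exact LinearMap.congr_fun (LinearMap.ker_eq_top.1 this) a

end Retract

/-! ### The comparison map from differential forms -/

section FormsMap

variable {k : Type u} [Field k] {B : Type v} [CommRing B] [Algebra k B]
  {A : Type v} [Ring A] [Algebra k A] [Algebra B A] [IsScalarTower k B A]
  {𝒜 : ZMod 2 → Submodule k A} [GradedAlgebra 𝒜] [SuperCommutative 𝒜] (u : OddVectorField 𝒜)
  {π : A →ₐ[B] B} (h : IsRetract 𝒜 π)

/-- The derivation `b ↦ u(b)`, where functions on `Spec B` are pulled back along the retraction. -/
def baseDerivation : Derivation k B A :=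
  Derivation.mk' (u.toLinearMap ∘ₗ (IsScalarTower.toAlgHom k B A).toLinearMap) fun a b => by
    change u.toLinearMap (algebraMap B A (a * b)) =
      a • u.toLinearMap (algebraMap B A b) + b • u.toLinearMap (algebraMap B A a)
    rw [map_mul, u.leibniz_even _ (h.algebraMap_mem a), ← Algebra.commutes, ← Algebra.smul_def,
      ← Algebra.smul_def, add_comm]

/-- The `B`-linear map `db ↦ u(b)`. -/
def oneFormMap : Ω[B⁄k] →ₗ[B] A := (baseDerivation u h).liftKaehlerDifferential

theorem oneFormMap_D (b : B) :
    oneFormMap u h (KaehlerDifferential.D k B b) = u.toLinearMap (algebraMap B A b) :=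
  (baseDerivation u h).liftKaehlerDifferential_comp_D b

theorem oneFormMap_mem (ω : Ω[B⁄k]) : oneFormMap u h ω ∈ 𝒜 1 := by
  have hω : ω ∈ Submodule.span B (Set.range (KaehlerDifferential.D k B)) := by
    rw [KaehlerDifferential.span_range_derivation]; trivial
  induction hω using Submodule.span_induction with
  | mem x hx =>
    obtain ⟨b, rfl⟩ := hx
    rw [oneFormMap_D]
    exact OddVectorField.odd_of_even (h.algebraMap_mem b)
  | zero => rw [map_zero]; exact zero_mem _
  | add x y _ _ hx hy => rw [map_add]; exact add_mem hx hy
  | smul b x _ hx =>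
    rw [map_smul, Algebra.smul_def]
    exact mul_mem_of_even_odd 𝒜 (h.algebraMap_mem b) hx

variable [CharZero k]

/-- The homomorphism `Ω^• → A` of `B`-algebras with `db ↦ u(b)`. -/
def formsMap : Forms k B →ₐ[B] A :=
  ExteriorAlgebra.lift B ⟨oneFormMap u h, fun ω => mul_self_of_odd 𝒜 (oneFormMap_mem u h ω)⟩

theorem formsMap_ι (ω : Ω[B⁄k]) : formsMap u h (ExteriorAlgebra.ι B ω) = oneFormMap u h ω :=
  ExteriorAlgebra.lift_ι_apply B _ _ _

theorem range_oneFormMap_le : LinearMap.range (oneFormMap u h) ≤ augIdeal π := by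
  rintro _ ⟨ω, rfl⟩
  exact h.odd_mem (oneFormMap_mem u h ω)

theorem augIdeal_mul_le (π : A →ₐ[B] B) (M : Submodule B A) : augIdeal π * M ≤ augIdeal π :=
  Submodule.mul_le.2 fun a ha b _ => by
    rw [mem_augIdeal] at ha ⊢
    rw [map_mul, ha, zero_mul]

theorem mul_augIdeal_le (π : A →ₐ[B] B) (M : Submodule B A) : M * augIdeal π ≤ augIdeal π :=
  Submodule.mul_le.2 fun a _ b hb => by
    rw [mem_augIdeal] at hb ⊢
    rw [map_mul, hb, mul_zero]

theorem pow_le_pow_sup_pow_succ {V : Submodule B A} (hV : V ≤ augIdeal π)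
    (hJ : augIdeal π ≤ V ⊔ augIdeal π * augIdeal π) (j : ℕ) :
    augIdeal π ^ j ≤ V ^ j ⊔ augIdeal π ^ (j + 1) := by
  induction j with
  | zero => rw [pow_zero, pow_zero]; exact le_sup_left
  | succ j ih =>
    rw [← Submodule.add_eq_sup] at ih hJ ⊢
    have h1 : V + augIdeal π * augIdeal π ≤ augIdeal π := sup_le hV (augIdeal_mul_le π _)
    calc augIdeal π ^ (j + 1) = augIdeal π ^ j * augIdeal π := pow_succ _ _
      _ ≤ (V ^ j + augIdeal π ^ (j + 1)) * (V + augIdeal π * augIdeal π) := mul_le_mul' ih hJ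
      _ = V ^ j * V + V ^ j * (augIdeal π * augIdeal π) +
          augIdeal π ^ (j + 1) * (V + augIdeal π * augIdeal π) := by
        rw [add_mul, mul_add]
      _ ≤ V ^ (j + 1) + augIdeal π ^ (j + 1 + 1) + augIdeal π ^ (j + 1 + 1) := by
        refine add_le_add (add_le_add (pow_succ _ _).ge ?_) ?_
        · rw [pow_succ (augIdeal π) (j + 1), pow_succ (augIdeal π) j, mul_assoc]
          exact mul_le_mul' (pow_le_pow_left' hV j) le_rfl
        · rw [pow_succ (augIdeal π) (j + 1)]
          exact mul_le_mul' le_rfl h1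
      _ = V ^ (j + 1) + augIdeal π ^ (j + 1 + 1) := by
        rw [add_assoc, Submodule.add_eq_sup (augIdeal π ^ _), sup_idem]

theorem formsMap_surjective_of_le (hJn : IsNilpotent (augIdeal π))
    (hJ : augIdeal π ≤ LinearMap.range (oneFormMap u h) ⊔ augIdeal π * augIdeal π) :
    Function.Surjective (formsMap u h) := by
  set P : Subalgebra B A := (formsMap u h).range with hP
  have hVP : ∀ j, LinearMap.range (oneFormMap u h) ^ j ≤ Subalgebra.toSubmodule P := by
    intro j
    induction j with
    | zero =>
      rw [pow_zero]
      intro a ha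
      obtain ⟨b, rfl⟩ := Submodule.mem_one.1 ha
      exact P.algebraMap_mem b
    | succ j ih =>
      rw [pow_succ]
      refine Submodule.mul_le.2 fun a ha b hb => P.mul_mem (ih ha) ?_
      obtain ⟨ω, rfl⟩ := hb
      exact ⟨ExteriorAlgebra.ι B ω, formsMap_ι u h ω⟩
  have key : ∀ j, (⊤ : Submodule B A) ≤ Subalgebra.toSubmodule P ⊔ augIdeal π ^ (j + 1) := by
    intro j
    induction j with
    | zero =>
      intro a _
      rw [zero_add, pow_one, ← add_sub_cancel (algebraMap B A (π a)) a]
      exact add_mem (Submodule.mem_sup_left (P.algebraMap_mem _))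
        (Submodule.mem_sup_right (sub_mem_augIdeal π a))
    | succ j ih =>
      refine ih.trans (sup_le le_sup_left ?_)
      exact (pow_le_pow_sup_pow_succ (range_oneFormMap_le u h) hJ (j + 1)).trans
        (sup_le_sup_right (hVP _) _)
  obtain ⟨N, hN⟩ := hJn
  intro a
  have ha := key N (Submodule.mem_top (x := a))
  rw [pow_succ, hN, zero_mul, Submodule.zero_eq_bot, sup_bot_eq] at ha
  exact ha

variable [IsAlgClosed k] [Algebra.FiniteType k A]

/-- The odd cotangent spaces are spanned by the values of `u` on even functions; by Nakayama's lemma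
the ideal of odd functions is generated by the `u(b)`. -/
theorem formsMap_surjective (hvan : ∀ x : A →ₐ[k] k, u.VanishesAt x)
    (heven : ∀ x : A →ₐ[k] k, Set.BijOn (OddVectorField.cotangentMap (hvan x))
      (cotangentPart 𝒜 x 0) (cotangentPart 𝒜 x 1)) :
    Function.Surjective (formsMap u h) := by
  refine formsMap_surjective_of_le u h h.isNilpotent ?_
  have hB : Algebra.FiniteType k B := finiteType_base π
  have hBN : IsNoetherianRing B := Algebra.FiniteType.isNoetherianRing k B
  have hA : Module.Finite B A := h.finite
  set V := LinearMap.range (oneFormMap u h) with hV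
  set J := augIdeal π with hJ
  have hbot : J.map (V ⊔ J * J).mkQ = ⊥ := by
    refine eq_bot_of_forall_point (k := k) _ ((IsNoetherian.noetherian J).map _) fun y => ?_
    rw [← Submodule.map_smul'']
    rintro _ ⟨a, ha, rfl⟩
    suffices hs : a ∈ (V ⊔ J * J) ⊔ (RingHom.ker y : Ideal B) • J by
      obtain ⟨s, hs', t, ht, rfl⟩ := Submodule.mem_sup.1 hs
      refine ⟨t, ht, ?_⟩
      have h0 : (V ⊔ J * J).mkQ s = 0 := (Submodule.Quotient.mk_eq_zero _).2 hs'
      rw [map_add, h0, zero_add]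
    obtain ⟨a₀, ha₀, a₁, ha₁, rfl⟩ := exists_even_add_odd 𝒜 a
    have hπ₀ : π a₀ = 0 := by
      have h1 : π (a₀ + a₁) = 0 := ha
      rwa [map_add, show π a₁ = 0 from h.odd_mem ha₁, add_zero] at h1
    refine add_mem (Submodule.mem_sup_left (Submodule.mem_sup_right (h.even_mem_mul ha₀ hπ₀))) ?_
    obtain ⟨c, hc, hca⟩ := OddVectorField.exists_apply_sub_mem _ (heven (liftPoint π y)) ha₁
    -- Replace `c` by its restriction to `Spec B`, which changes `u c` by an element of `𝔪ₓ²`.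
    have hc' : u.toLinearMap (c - algebraMap B A (π c)) ∈
        maxIdeal (liftPoint π y) * maxIdeal (liftPoint π y) :=
      OddVectorField.map_sq_le (hvan _) _ (augIdeal_mul_le_maxIdeal_mul π y
        (h.even_mem_mul (sub_mem hc (h.algebraMap_mem _)) (sub_mem_augIdeal π c)))
    have hodd : u.toLinearMap (algebraMap B A (π c)) - a₁ ∈ 𝒜 1 :=
      sub_mem (OddVectorField.odd_of_even (h.algebraMap_mem _)) ha₁
    have hz := sub_mem hca hc'
    rw [map_sub u.toLinearMap, sub_right_comm, sub_sub_self] at hz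
    replace hz := (of_mem_maxIdeal_mul π y hz).2
    rw [show π _ = 0 from h.odd_mem hodd, map_zero, sub_zero] at hz
    have ha₁' : a₁ = oneFormMap u h (KaehlerDifferential.D k B (π c)) -
        (u.toLinearMap (algebraMap B A (π c)) - a₁) := by
      rw [oneFormMap_D, sub_sub_self]
    rw [ha₁']
    refine sub_mem (Submodule.mem_sup_left (Submodule.mem_sup_left ⟨_, rfl⟩)) ?_
    exact (sup_le le_sup_right (le_sup_right.trans le_sup_left) : (RingHom.ker y : Ideal B) • J ⊔
      J * J ≤ (V ⊔ J * J) ⊔ (RingHom.ker y : Ideal B) • J) hz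
  have hle := LinearMap.le_ker_iff_map.2 hbot
  rwa [Submodule.ker_mkQ] at hle

end FormsMap

/-! ### The superalgebra of differential forms -/

namespace Forms

variable {k : Type u} {B : Type v} [Field k] [CommRing B] [Algebra k B]

variable (k B) in
/-- The parity decomposition of the algebra of forms, as a grading over the ground field. -/
def grading (i : ZMod 2) : Submodule k (Forms k B) := (parity k B i).restrictScalars k

instance : GradedAlgebra (grading k B) :=
  let h : GradedAlgebra (CliffordAlgebra.evenOdd (0 : QuadraticForm B Ω[B⁄k])) := inferInstance
  { one_mem := h.one_mem
    mul_mem := h.mul_mem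
    decompose' := h.decompose'
    left_inv := h.left_inv
    right_inv := h.right_inv }

theorem sign_of_even {a : Forms k B} (ha : a ∈ grading k B 0) : sign k B a = a :=
  CliffordAlgebra.involute_eq_of_mem_even ha

theorem sign_of_odd {a : Forms k B} (ha : a ∈ grading k B 1) : sign k B a = -a :=
  CliffordAlgebra.involute_eq_of_mem_odd ha

theorem algebraMap_mem (b : B) : algebraMap B (Forms k B) b ∈ grading k B 0 :=
  SetLike.algebraMap_mem_graded (CliffordAlgebra.evenOdd (0 : QuadraticForm B Ω[B⁄k])) b

theorem ι_mem (ω : Ω[B⁄k]) : ExteriorAlgebra.ι B ω ∈ grading k B 1 :=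
  CliffordAlgebra.ι_mem_evenOdd_one 0 ω

instance : SuperCommutative (grading k B) where
  even_comm a ha b := by
    induction b using ExteriorAlgebra.induction with
    | algebraMap r => exact (Algebra.commutes r a).symm
    | ι ω => rw [ι_mul, sign_of_even ha]
    | mul b c hb hc => rw [← mul_assoc, hb, mul_assoc, hc, mul_assoc]
    | add b c hb hc => rw [mul_add, add_mul, hb, hc]
  odd_anticomm a ha b hb := by
    replace ha : a ∈ CliffordAlgebra.evenOdd (0 : QuadraticForm B Ω[B⁄k]) 1 := ha
    have hι : ∀ ω : Ω[B⁄k], ExteriorAlgebra.ι B ω * b = -(b * ExteriorAlgebra.ι B ω) := fun ω => by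
      rw [ι_mul, sign_of_odd hb, neg_mul]
    induction a, ha using CliffordAlgebra.evenOdd_induction with
    | range_ι_pow v hv =>
      rw [show (1 : ZMod 2).val = 1 from rfl, pow_one] at hv
      obtain ⟨ω, rfl⟩ := hv
      exact hι ω
    | add x y _ _ hx hy => rw [add_mul, mul_add, hx, hy, neg_add]
    | ι_mul_ι_mul ω η x _ hx =>
      change ExteriorAlgebra.ι B ω * ExteriorAlgebra.ι B η * x * b =
        -(b * (ExteriorAlgebra.ι B ω * ExteriorAlgebra.ι B η * x))
      rw [mul_assoc, hx, mul_neg, ← mul_assoc, mul_assoc _ _ b, hι η, mul_neg, neg_mul,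
        ← mul_assoc, hι ω]
      noncomm_ring

variable (k B) in
/-- The projection to forms of degree zero. -/
def aug : Forms k B →ₐ[B] B := ExteriorAlgebra.algebraMapInv

theorem aug_ι (ω : Ω[B⁄k]) : aug k B (ExteriorAlgebra.ι B ω) = 0 := by
  rw [aug, ExteriorAlgebra.algebraMapInv, ExteriorAlgebra.lift_ι_apply]
  rfl

variable (k B) in
/-- The projection to forms of degree one. -/
def degOne : Forms k B →ₗ[B] Ω[B⁄k] := ExteriorAlgebra.ιInv

theorem degOne_ι (ω : Ω[B⁄k]) : degOne k B (ExteriorAlgebra.ι B ω) = ω :=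
  ExteriorAlgebra.ι_leftInverse ω

theorem degOne_mul (a b : Forms k B) :
    degOne k B (a * b) = aug k B a • degOne k B b + aug k B b • degOne k B a := by
  let _ : Module Bᵐᵒᵖ Ω[B⁄k] := Module.compHom _ ((RingHom.id B).fromOpposite mul_comm)
  have _ : IsCentralScalar B Ω[B⁄k] := ⟨fun _ _ => rfl⟩
  have hfst : (TrivSqZeroExt.fstHom B B Ω[B⁄k]).comp ExteriorAlgebra.toTrivSqZeroExt =
      aug k B := by
    ext ω
    simp [aug_ι]
  have hfst' : ∀ c : Forms k B, (ExteriorAlgebra.toTrivSqZeroExt c).fst = aug k B c := fun c =>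
    AlgHom.congr_fun hfst c
  change (ExteriorAlgebra.toTrivSqZeroExt (a * b)).snd =
    aug k B a • (ExteriorAlgebra.toTrivSqZeroExt b).snd +
      aug k B b • (ExteriorAlgebra.toTrivSqZeroExt a).snd
  rw [map_mul, TrivSqZeroExt.snd_mul, hfst', hfst', op_smul_eq_smul]

theorem sub_mem_augIdeal_mul (a : Forms k B) :
    a - algebraMap B _ (aug k B a) - ExteriorAlgebra.ι B (degOne k B a) ∈
      augIdeal (aug k B) * augIdeal (aug k B) := by
  induction a using ExteriorAlgebra.induction with
  | algebraMap r =>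
    have h1 : degOne k B 1 = 0 := by simpa using degOne_mul (1 : Forms k B) 1
    rw [AlgHom.commutes, Algebra.algebraMap_eq_smul_one, map_smul, h1]
    simp [Algebra.algebraMap_eq_smul_one]
  | ι ω => rw [aug_ι, degOne_ι]; simp
  | mul a b ha hb =>
    have key : a * b - algebraMap B _ (aug k B (a * b)) -
        ExteriorAlgebra.ι B (degOne k B (a * b)) =
        aug k B a • (b - algebraMap B _ (aug k B b) - ExteriorAlgebra.ι B (degOne k B b)) +
        aug k B b • (a - algebraMap B _ (aug k B a) - ExteriorAlgebra.ι B (degOne k B a)) +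
        (a - algebraMap B _ (aug k B a)) * (b - algebraMap B _ (aug k B b)) := by
      rw [degOne_mul, map_add, map_smul, map_smul, smul_sub, smul_sub, smul_sub, smul_sub, map_mul,
        map_mul, sub_mul, mul_sub a, mul_sub, ← Algebra.commutes (aug k B b) a,
        ← Algebra.smul_def, ← Algebra.smul_def, ← Algebra.smul_def,
        Algebra.smul_def _ (algebraMap B (Forms k B) (aug k B a)), ← map_mul,
        mul_comm (aug k B b), map_mul, ← Algebra.smul_def]
      abel
    rw [key]
    exact add_mem (add_mem (Submodule.smul_mem _ _ hb) (Submodule.smul_mem _ _ ha))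
      (Submodule.mul_mem_mul (sub_mem_augIdeal _ a) (sub_mem_augIdeal _ b))
  | add a b ha hb =>
    have := add_mem ha hb
    simp only [map_add]
    convert this using 1
    abel

theorem degOne_of_mem_mul {a : Forms k B} (ha : a ∈ augIdeal (aug k B) * augIdeal (aug k B)) :
    degOne k B a = 0 := by
  induction ha using Submodule.mul_induction_on' with
  | mem_mul_mem a ha b hb =>
    rw [degOne_mul, show aug k B a = 0 from ha, show aug k B b = 0 from hb, zero_smul, zero_smul,
      add_zero]
  | add a _ b _ ha hb => rw [map_add, ha, hb, add_zero]

variable [Algebra.FiniteType k B]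

/-- Forms of positive degree are generated by finitely many `1`-forms. -/
theorem exists_finite : ∃ S : Set (Forms k B), S.Finite ∧ S ⊆ grading k B 1 ∧
    ∀ a, a ∈ augIdeal (aug k B) ↔ a ∈ Ideal.span S := by
  obtain ⟨G, hG⟩ := (Module.Finite.fg_top : (⊤ : Submodule B Ω[B⁄k]).FG)
  set S := ExteriorAlgebra.ι B '' (G : Set Ω[B⁄k]) with hS
  have hι : ∀ ω : Ω[B⁄k], ExteriorAlgebra.ι B ω ∈ (⊤ * Submodule.span B S :
      Submodule B (Forms k B)) := by
    intro ω
    rw [← one_mul (ExteriorAlgebra.ι B ω)]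
    refine Submodule.mul_mem_mul trivial ?_
    rw [hS, ← Submodule.map_span, hG]
    exact ⟨ω, trivial, rfl⟩
  refine ⟨S, G.finite_toSet.image _, ?_, fun a => ⟨fun ha => ?_, fun ha => ?_⟩⟩
  · rintro _ ⟨ω, -, rfl⟩
    exact ι_mem ω
  · have key : a - algebraMap B _ (aug k B a) ∈ (⊤ * Submodule.span B S :
        Submodule B (Forms k B)) := by
      clear ha
      induction a using ExteriorAlgebra.induction with
      | algebraMap r => rw [AlgHom.commutes]; simp
      | ι ω => rw [aug_ι, map_zero, sub_zero]; exact hι ω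
      | mul a b ha hb =>
        have : a * b - algebraMap B _ (aug k B (a * b)) = a * (b - algebraMap B _ (aug k B b)) +
            aug k B b • (a - algebraMap B _ (aug k B a)) := by
          rw [map_mul, map_mul, Algebra.smul_def, mul_sub, mul_sub,
            Algebra.commutes (aug k B b) a, Algebra.commutes (aug k B b) (algebraMap B _ _)]
          abel
        rw [this]
        refine add_mem ?_ (Submodule.smul_mem _ _ ha)
        rw [mem_top_mul_span_iff] at hb ⊢
        exact Ideal.mul_mem_left _ _ hb
      | add a b ha hb =>
        rw [map_add, map_add, add_sub_add_comm]
        exact add_mem ha hb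
    rw [show aug k B a = 0 from ha, map_zero, sub_zero] at key
    exact (mem_top_mul_span_iff B).1 key
  · refine (mul_augIdeal_le (aug k B) ⊤ : _ ≤ _) ?_
    refine (mul_le_mul' le_rfl (Submodule.span_le.2 ?_) :
      (⊤ * Submodule.span B S : Submodule B (Forms k B)) ≤ ⊤ * augIdeal (aug k B))
      ((mem_top_mul_span_iff B).2 ha)
    rintro _ ⟨ω, -, rfl⟩
    exact aug_ι ω

variable [CharZero k]

theorem isNilpotent_augIdeal : IsNilpotent (augIdeal (aug k B)) := by
  obtain ⟨S, hf, hS, h⟩ := exists_finite (k := k) (B := B)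
  have : augIdeal (aug k B) = ⊤ * Submodule.span B S := by
    ext a
    rw [mem_top_mul_span_iff, h]
  rw [this]
  exact isNilpotent_top_mul_span_odd (grading k B) B hf hS

theorem isNilpotent_of_le {K : Submodule k (Forms k B)}
    (hK : ∀ a ∈ K, a ∈ augIdeal (aug k B)) : IsNilpotent K := by
  obtain ⟨S, hf, hS, h⟩ := exists_finite (k := k) (B := B)
  obtain ⟨N, hN⟩ := isNilpotent_top_mul_span_odd (grading k B) k hf hS
  refine ⟨N, le_bot_iff.1 ?_⟩
  refine (pow_le_pow_left' (fun a ha => ?_) N).trans hN.le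
  exact (mem_top_mul_span_iff k).2 ((h a).1 (hK a ha))

end Forms

/-! ### The comparison map is an isomorphism -/

section Compare

variable {k : Type u} [Field k] [CharZero k] {B : Type v} [CommRing B] [Algebra k B]
  {A : Type v} [Ring A] [Algebra k A] [Algebra B A] [IsScalarTower k B A]
  {𝒜 : ZMod 2 → Submodule k A} [GradedAlgebra 𝒜] [SuperCommutative 𝒜] (u : OddVectorField 𝒜)
  {π : A →ₐ[B] B} (h : IsRetract 𝒜 π)

theorem formsMap_mem {i : ZMod 2} {a : Forms k B} (ha : a ∈ Forms.grading k B i) :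
    formsMap u h a ∈ 𝒜 i := by
  replace ha : a ∈ CliffordAlgebra.evenOdd (0 : QuadraticForm B Ω[B⁄k]) i := ha
  induction a, ha using CliffordAlgebra.evenOdd_induction with
  | range_ι_pow v hv =>
    rcases zmod_cases i with rfl | rfl
    · rw [ZMod.val_zero, pow_zero] at hv
      obtain ⟨b, rfl⟩ := Submodule.mem_one.1 hv
      rw [AlgHom.commutes (formsMap u h) b]
      exact h.algebraMap_mem b
    · rw [show (1 : ZMod 2).val = 1 from rfl, pow_one] at hv
      obtain ⟨ω, rfl⟩ := hv
      exact (formsMap_ι u h ω).symm ▸ oneFormMap_mem u h ω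
  | add x y _ _ hx hy => rw [map_add]; exact add_mem hx hy
  | ι_mul_ι_mul ω η x _ hx =>
    have hωη : formsMap u h (ExteriorAlgebra.ι B ω * ExteriorAlgebra.ι B η) ∈ 𝒜 0 := by
      rw [map_mul, formsMap_ι, formsMap_ι]
      exact mul_mem_of_odd_odd 𝒜 (oneFormMap_mem u h ω) (oneFormMap_mem u h η)
    have := SetLike.GradedMul.mul_mem (A := 𝒜) hωη hx
    rw [zero_add, ← map_mul] at this
    exact this

theorem mem_grading_of_formsMap_mem (hinj : Function.Injective (formsMap u h)) {i : ZMod 2}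
    {a : Forms k B} (ha : formsMap u h a ∈ 𝒜 i) : a ∈ Forms.grading k B i := by
  obtain ⟨a₀, ha₀, a₁, ha₁, rfl⟩ := exists_even_add_odd (Forms.grading k B) a
  have h₀ := formsMap_mem u h ha₀
  have h₁ := formsMap_mem u h ha₁
  rw [map_add] at ha
  rcases zmod_cases i with rfl | rfl
  · have : formsMap u h a₁ = 0 :=
      eq_zero_of_even_of_odd 𝒜 (by simpa using sub_mem ha h₀) h₁
    rw [(map_eq_zero_iff _ hinj).1 this, add_zero]
    exact ha₀
  · have : formsMap u h a₀ = 0 :=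
      eq_zero_of_even_of_odd 𝒜 h₀ (by simpa using sub_mem ha h₁)
    rw [(map_eq_zero_iff _ hinj).1 this, zero_add]
    exact ha₁

theorem leibniz_formsMap (a : Forms k B) (x : A) : u.toLinearMap (formsMap u h a * x) =
    u.toLinearMap (formsMap u h a) * x + formsMap u h (Forms.sign k B a) * u.toLinearMap x := by
  obtain ⟨a₀, ha₀, a₁, ha₁, rfl⟩ := exists_even_add_odd (Forms.grading k B) a
  simp only [map_add, add_mul]
  rw [u.leibniz_even _ (formsMap_mem u h ha₀), u.leibniz_odd _ (formsMap_mem u h ha₁),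
    Forms.sign_of_even ha₀, Forms.sign_of_odd ha₁, map_neg, neg_mul]
  abel

/-- If `u² = 0`, the comparison map intertwines the de Rham differential with `u`. -/
theorem formsMap_deRham (hsq : ∀ a, u.toLinearMap (u.toLinearMap a) = 0) (a : Forms k B) :
    formsMap u h (deRham k B a) = u.toLinearMap (formsMap u h a) := by
  have hb : ∀ b : B, formsMap u h (deRham k B (algebraMap B _ b)) =
      u.toLinearMap (formsMap u h (algebraMap B _ b)) := fun b => by
    rw [deRham_algebraMap, AlgHom.commutes, Forms.ofD, formsMap_ι, oneFormMap_D]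
  have hmul : ∀ a b : Forms k B, formsMap u h (deRham k B a) = u.toLinearMap (formsMap u h a) →
      formsMap u h (deRham k B b) = u.toLinearMap (formsMap u h b) →
      formsMap u h (deRham k B (a * b)) = u.toLinearMap (formsMap u h (a * b)) :=
    fun a b ha hb => by
      rw [deRham_mul, map_add, map_mul, map_mul, map_mul, ha, hb, leibniz_formsMap]
  induction a using ExteriorAlgebra.induction with
  | algebraMap b => exact hb b
  | ι ω =>
    have hω : ω ∈ Submodule.span B (Set.range (KaehlerDifferential.D k B)) := by
      rw [KaehlerDifferential.span_range_derivation]; trivial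
    induction hω using Submodule.span_induction with
    | mem x hx =>
      obtain ⟨b, rfl⟩ := hx
      rw [← Forms.ofD, deRham_ofD, map_zero, Forms.ofD, formsMap_ι, oneFormMap_D, hsq]
    | zero => simp
    | add x y _ _ hx hy => simp only [map_add, hx, hy]
    | smul b x _ hx =>
      rw [map_smul, Algebra.smul_def]
      exact hmul _ _ (hb b) hx
  | mul a b ha hb => exact hmul a b ha hb
  | add a b ha hb => simp only [map_add, ha, hb]

theorem retract_formsMap (a : Forms k B) : π (formsMap u h a) = Forms.aug k B a := by
  have : π.comp (formsMap u h) = Forms.aug k B := by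
    refine ExteriorAlgebra.hom_ext (LinearMap.ext fun ω => ?_)
    change π (formsMap u h (ExteriorAlgebra.ι B ω)) = Forms.aug k B (ExteriorAlgebra.ι B ω)
    rw [formsMap_ι, Forms.aug_ι]
    exact h.odd_mem (oneFormMap_mem u h ω)
  exact AlgHom.congr_fun this a

theorem formsMap_mem_augIdeal_mul {a : Forms k B}
    (ha : a ∈ augIdeal (Forms.aug k B) * augIdeal (Forms.aug k B)) :
    formsMap u h a ∈ augIdeal π * augIdeal π := by
  induction ha using Submodule.mul_induction_on' with
  | mem_mul_mem a ha b hb =>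
    rw [map_mul]
    refine Submodule.mul_mem_mul ?_ ?_ <;> rw [mem_augIdeal, retract_formsMap]
    exacts [ha, hb]
  | add a _ b _ ha hb => rw [map_add]; exact add_mem ha hb

theorem oneFormMap_mem_maxIdeal_mul (y : B →ₐ[k] k) {ω : Ω[B⁄k]}
    (hω : ω ∈ ((RingHom.ker y : Ideal B) • ⊤ : Submodule B Ω[B⁄k])) :
    oneFormMap u h ω ∈ maxIdeal (liftPoint π y) * maxIdeal (liftPoint π y) := by
  induction hω using Submodule.smul_induction_on' with
  | smul r hr η _ =>
    rw [map_smul]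
    exact smul_mem_maxIdeal_mul π y hr (point_odd 𝒜 (liftPoint π y) _ (oneFormMap_mem u h η))
  | add a _ b _ ha hb => rw [map_add]; exact add_mem ha hb

/-- At a closed point every `1`-form agrees with an exact one. -/
theorem exists_sub_D_mem (y : B →ₐ[k] k) (ω : Ω[B⁄k]) : ∃ c : B, y c = 0 ∧
    ω - KaehlerDifferential.D k B c ∈ ((RingHom.ker y : Ideal B) • ⊤ : Submodule B Ω[B⁄k]) := by
  have hω : ω ∈ Submodule.span B (Set.range (KaehlerDifferential.D k B)) := by
    rw [KaehlerDifferential.span_range_derivation]; trivial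
  induction hω using Submodule.span_induction with
  | mem x hx =>
    obtain ⟨b, rfl⟩ := hx
    refine ⟨b - algebraMap k B (y b), by simp, ?_⟩
    rw [map_sub, Derivation.map_algebraMap, sub_zero, sub_self]
    exact zero_mem _
  | zero => exact ⟨0, map_zero _, by simp⟩
  | add x x' _ _ hx hx' =>
    obtain ⟨c, hc, hc'⟩ := hx
    obtain ⟨d, hd, hd'⟩ := hx'
    refine ⟨c + d, by rw [map_add, hc, hd, add_zero], ?_⟩
    rw [map_add, add_sub_add_comm]
    exact add_mem hc' hd'
  | smul b x _ hx =>
    obtain ⟨c, hc, hc'⟩ := hx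
    refine ⟨y b • c, by rw [map_smul, hc, smul_zero], ?_⟩
    have : b • x - KaehlerDifferential.D k B (y b • c) = (b - algebraMap k B (y b)) • x +
        algebraMap k B (y b) • (x - KaehlerDifferential.D k B c) := by
      rw [Derivation.map_smul, sub_smul, smul_sub, algebraMap_smul, algebraMap_smul]
      abel
    rw [this]
    exact add_mem (Submodule.smul_mem_smul (by simp [RingHom.mem_ker]) trivial)
      (Submodule.smul_mem _ _ hc')

theorem D_mem_of_mem_sq (I : Ideal B) {c : B} (hc : c ∈ I ^ 2) :
    KaehlerDifferential.D k B c ∈ (I • ⊤ : Submodule B Ω[B⁄k]) := by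
  rw [pow_two] at hc
  induction hc using Submodule.mul_induction_on' with
  | mem_mul_mem a ha b hb =>
    rw [Derivation.leibniz]
    exact add_mem (Submodule.smul_mem_smul ha trivial) (Submodule.smul_mem_smul hb trivial)
  | add a _ b _ ha hb => rw [map_add]; exact add_mem ha hb

/-- Injectivity of `u` on the even cotangent space bounds the kernel of `db ↦ u(b)` modulo `J²`. -/
theorem mem_smul_of_oneFormMap_mem (y : B →ₐ[k] k) (hx : u.VanishesAt (liftPoint π y))
    (heven : Set.BijOn (OddVectorField.cotangentMap hx)
      (cotangentPart 𝒜 (liftPoint π y) 0) (cotangentPart 𝒜 (liftPoint π y) 1))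
    {ω : Ω[B⁄k]} (hω : oneFormMap u h ω ∈ augIdeal π * augIdeal π) :
    ω ∈ ((RingHom.ker y : Ideal B) • ⊤ : Submodule B Ω[B⁄k]) := by
  obtain ⟨c, hc, hc'⟩ := exists_sub_D_mem y ω
  have h1 : u.toLinearMap (algebraMap B A c) ∈
      maxIdeal (liftPoint π y) * maxIdeal (liftPoint π y) := by
    rw [← oneFormMap_D u h, ← sub_sub_self ω (KaehlerDifferential.D k B c), map_sub]
    exact sub_mem (augIdeal_mul_le_maxIdeal_mul π y hω) (oneFormMap_mem_maxIdeal_mul u h y hc')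
  have h2 := OddVectorField.mem_of_apply_mem hx heven (h.algebraMap_mem c)
    (algebraMap_mem_maxIdeal π y hc) h1
  have h3 := (of_mem_maxIdeal_mul π y h2).1
  rw [AlgHom.commutes, Algebra.algebraMap_self_apply] at h3
  have := add_mem hc' (D_mem_of_mem_sq (k := k) (RingHom.ker y : Ideal B) h3)
  rwa [sub_add_cancel] at this

variable [IsAlgClosed k]

/-- A right inverse of the comparison map, which exists by smoothness, splits off its kernel. The
part of the kernel linear in `Ω` is then a direct summand of `Ω` vanishing at every closed point,
so it is zero, and the kernel lies in every power of the augmentation ideal. -/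
theorem formsMap_injective_of_rightInverse [Algebra.FiniteType k A]
    (hvan : ∀ x : A →ₐ[k] k, u.VanishesAt x)
    (heven : ∀ x : A →ₐ[k] k, Set.BijOn (OddVectorField.cotangentMap (hvan x))
      (cotangentPart 𝒜 x 0) (cotangentPart 𝒜 x 1))
    (g : A →ₐ[k] Forms k B) (hg : ∀ a, formsMap u h (g a) = a) :
    Function.Injective (formsMap u h) := by
  have hB : Algebra.FiniteType k B := finiteType_base π
  set I := augIdeal (Forms.aug k B) with hI
  set e : Forms k B →ₐ[k] Forms k B := g.comp ((formsMap u h).restrictScalars k) with he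
  have hψe : ∀ z, formsMap u h (e z) = formsMap u h z := fun z => hg _
  have hker : ∀ z, formsMap u h z = 0 → z ∈ I := fun z hz => by
    rw [hI, mem_augIdeal, ← retract_formsMap u h, hz, map_zero]
  have hfker : ∀ z, formsMap u h (z - e z) = 0 := fun z => by rw [map_sub, hψe, sub_self]
  have hfI : ∀ z, z - e z ∈ I := fun z => hker _ (hfker z)
  have hfid : ∀ z, formsMap u h z = 0 → z - e z = z := fun z hz => by
    have : e z = g (formsMap u h z) := rfl
    rw [this, hz, map_zero, sub_zero]
  have heI : ∀ z ∈ I, e z ∈ I := fun z hz => by simpa using sub_mem hz (hfI z)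
  have hII : ∀ z ∈ I * I, e z ∈ I * I := fun z hz => by
    induction hz using Submodule.mul_induction_on' with
    | mem_mul_mem a ha b hb =>
      rw [map_mul]
      exact Submodule.mul_mem_mul (heI a ha) (heI b hb)
    | add a _ b _ ha hb => rw [map_add]; exact add_mem ha hb
  have haug : ∀ z, Forms.aug k B (e z) = Forms.aug k B z := fun z => by
    have : Forms.aug k B (z - e z) = 0 := hfI z
    rw [map_sub, sub_eq_zero] at this
    exact this.symm
  have hιI : ∀ ω : Ω[B⁄k], ExteriorAlgebra.ι B ω ∈ I := fun ω => Forms.aug_ι ω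
  -- the linear part of the projection `1 - e` onto the kernel
  let q : Ω[B⁄k] →ₗ[B] Ω[B⁄k] :=
    { toFun := fun ω => Forms.degOne k B (ExteriorAlgebra.ι B ω - e (ExteriorAlgebra.ι B ω))
      map_add' := fun ω η => by simp only [map_add, map_sub]; abel
      map_smul' := fun b ω => by
        have h1 : e (ExteriorAlgebra.ι B (b • ω)) =
            e (algebraMap B _ b) * e (ExteriorAlgebra.ι B ω) := by
          rw [map_smul, Algebra.smul_def, map_mul]
        rw [h1, map_sub, Forms.degOne_mul, haug, haug, Forms.aug_ι, zero_smul, add_zero,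
          AlgHom.commutes, map_smul, map_smul, map_sub, smul_sub]
        rfl }
  have hq : ∀ ω, q ω = Forms.degOne k B (ExteriorAlgebra.ι B ω - e (ExteriorAlgebra.ι B ω)) :=
    fun _ => rfl
  have hrem : ∀ z ∈ I, z - ExteriorAlgebra.ι B (Forms.degOne k B z) ∈ I * I := fun z hz => by
    have := Forms.sub_mem_augIdeal_mul z
    rwa [show Forms.aug k B z = 0 from hz, map_zero, sub_zero] at this
  have hdeg : ∀ z ∈ I, Forms.degOne k B (z - e z) = q (Forms.degOne k B z) := fun z hz => by
    have h1 := hrem z hz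
    have h2 := Forms.degOne_of_mem_mul (hII _ h1)
    rw [map_sub, map_sub, sub_eq_zero] at h2
    rw [hq, map_sub, map_sub, h2, Forms.degOne_ι]
  have hqq : ∀ ω, q (q ω) = q ω := fun ω => by
    rw [hq ω, ← hdeg _ (hfI _), hfid _ (hfker _)]
  have hq0 : LinearMap.range q = ⊥ := by
    have hfg : (LinearMap.range q).FG := by
      rw [LinearMap.range_eq_map]
      exact Module.Finite.fg_top.map q
    refine eq_bot_of_forall_point (k := k) _ hfg fun y => ?_
    rintro _ ⟨ω, rfl⟩
    have hmem : oneFormMap u h (q ω) ∈ augIdeal π * augIdeal π := by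
      have := formsMap_mem_augIdeal_mul u h (hrem _ (hfI (ExteriorAlgebra.ι B ω)))
      rw [map_sub, hfker, zero_sub, formsMap_ι] at this
      exact neg_mem_iff.1 this
    have h1 := Submodule.mem_map_of_mem (f := q)
      (mem_smul_of_oneFormMap_mem u h y (hvan _) (heven _) hmem)
    rwa [hqq, Submodule.map_smul'', ← LinearMap.range_eq_map] at h1
  have hfII : ∀ z ∈ I, z - e z ∈ I * I := fun z hz => by
    have h1 := hrem _ (hfI z)
    have h2 : q (Forms.degOne k B z) = 0 := by
      have : q (Forms.degOne k B z) ∈ LinearMap.range q := ⟨_, rfl⟩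
      rwa [hq0, Submodule.mem_bot] at this
    rwa [hdeg z hz, h2, map_zero, sub_zero] at h1
  have hfpow : ∀ j, ∀ z ∈ I ^ j, z - e z ∈ I ^ (j + 1) := by
    intro j
    induction j with
    | zero => intro z _; rw [zero_add, pow_one]; exact hfI z
    | succ j ih =>
      intro z hz
      rw [pow_succ'] at hz
      induction hz using Submodule.mul_induction_on' with
      | mem_mul_mem a ha b hb =>
        have : a * b - e (a * b) = (a - e a) * b + e a * (b - e b) := by
          rw [map_mul]; noncomm_ring
        rw [this]
        refine add_mem ?_ ?_
        · rw [show j + 1 + 1 = 2 + j by ring, pow_add, pow_two]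
          exact Submodule.mul_mem_mul (hfII a ha) hb
        · rw [pow_succ' _ (j + 1)]
          exact Submodule.mul_mem_mul (heI a ha) (ih b hb)
      | add a _ b _ ha hb => rw [map_add, add_sub_add_comm]; exact add_mem ha hb
  rw [injective_iff_map_eq_zero]
  intro z hz
  have hz' : ∀ j, z ∈ I ^ (j + 1) := by
    intro j
    induction j with
    | zero => rw [zero_add, pow_one]; exact hker z hz
    | succ j ih => rw [← hfid z hz]; exact hfpow _ _ ih
  obtain ⟨N, hN⟩ := Forms.isNilpotent_augIdeal (k := k) (B := B)
  have := hz' N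
  rw [pow_succ, hN, zero_mul] at this
  simpa using this

theorem formsMap_bijective (hX : IsSmoothAffine 𝒜)
    (hvan : ∀ x : A →ₐ[k] k, u.VanishesAt x)
    (heven : ∀ x : A →ₐ[k] k, Set.BijOn (OddVectorField.cotangentMap (hvan x))
      (cotangentPart 𝒜 x 0) (cotangentPart 𝒜 x 1)) :
    Function.Bijective (formsMap u h) := by
  have hA := hX.finiteType
  have hB : Algebra.FiniteType k B := finiteType_base π
  have hsurj := formsMap_surjective u h hvan heven
  obtain ⟨g, -, hg⟩ := hX.exists_lift (Forms k B) A (Forms.grading k B) 𝒜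
    ((formsMap u h).restrictScalars k) (fun i a ha => formsMap_mem u h ha) hsurj
    (Forms.isNilpotent_of_le fun a ha => by
      rw [mem_augIdeal, ← retract_formsMap u h, show formsMap u h a = 0 from ha, map_zero])
    (AlgHom.id k A) fun i a ha => ha
  exact ⟨formsMap_injective_of_rightInverse u h hvan heven g fun a => AlgHom.congr_fun hg a, hsurj⟩

theorem exists_equiv_of_isRetract (h : IsRetract 𝒜 π) (hX : IsSmoothAffine 𝒜)
    (hu : u.IsHomological) (hvan : ∀ x : A →ₐ[k] k, u.VanishesAt x)
    (hodd : ∀ x : A →ₐ[k] k, ∀ ξ ∈ cotangentPart 𝒜 x 1,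
      OddVectorField.cotangentMap (hvan x) ξ = 0)
    (heven : ∀ x : A →ₐ[k] k, Set.BijOn (OddVectorField.cotangentMap (hvan x))
      (cotangentPart 𝒜 x 0) (cotangentPart 𝒜 x 1)) :
    ∃ φ : A ≃ₐ[k] Forms k B, (∀ i a, a ∈ 𝒜 i ↔ φ a ∈ Forms.parity k B i) ∧
      ∀ a, φ (u.toLinearMap a) = deRham k B (φ a) := by
  have hA := hX.finiteType
  have hbij := formsMap_bijective u h hX hvan heven
  let ψ : Forms k B ≃ₐ[k] A := AlgEquiv.ofBijective ((formsMap u h).restrictScalars k) hbij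
  have hψ : ∀ z, ψ z = formsMap u h z := fun _ => rfl
  refine ⟨ψ.symm, fun i a => ?_, fun a => ?_⟩ <;> obtain ⟨z, rfl⟩ := ψ.surjective a <;>
    rw [AlgEquiv.symm_apply_apply, hψ]
  · exact ⟨mem_grading_of_formsMap_mem u h hbij.1, formsMap_mem u h⟩
  · rw [← formsMap_deRham u h (h.sq_eq_zero hu hvan hodd), ← hψ, AlgEquiv.symm_apply_apply]

end Compare

/-! ### Splitting off the even part -/

section Split

variable {k : Type u} [Field k] {A : Type v} [Ring A] [Algebra k A]

/-- The `ℤ/2`-grading of a purely even algebra. -/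
def pureGrading (k : Type u) [Field k] (C : Type v) [Ring C] [Algebra k C] (i : ZMod 2) :
    Submodule k C :=
  if i = 0 then ⊤ else ⊥

section Pure

variable (C : Type v) [Ring C] [Algebra k C]

theorem mem_pureGrading_zero (c : C) : c ∈ pureGrading k C 0 := trivial

theorem mem_pureGrading_one {c : C} : c ∈ pureGrading k C 1 ↔ c = 0 := Submodule.mem_bot k

instance : GradedAlgebra (pureGrading k C) where
  one_mem := mem_pureGrading_zero C 1
  mul_mem i j a b ha hb := by
    rcases zmod_cases i with rfl | rfl
    · rcases zmod_cases j with rfl | rfl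
      · exact mem_pureGrading_zero C _
      · rw [(mem_pureGrading_one C).1 hb, mul_zero]
        exact zero_mem _
    · rw [(mem_pureGrading_one C).1 ha, zero_mul]
      exact zero_mem _
  decompose' c := DirectSum.of (fun i => pureGrading k C i) 0 ⟨c, mem_pureGrading_zero C c⟩
  left_inv c := DirectSum.coeAddMonoidHom_of _ _ _
  right_inv c := by
    induction c using DirectSum.induction_on with
    | zero => rw [map_zero]; exact map_zero (DirectSum.of (fun i => pureGrading k C i) 0)
    | of i x =>
      rw [DirectSum.coeAddMonoidHom_of]
      rcases zmod_cases i with rfl | rfl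
      · rfl
      · obtain ⟨x, hx⟩ := x
        obtain rfl := (mem_pureGrading_one C).1 hx
        exact (map_zero (DirectSum.of (fun i => pureGrading k C i) 0)).trans
          (map_zero (DirectSum.of (fun i => pureGrading k C i) 1)).symm
    | add x y hx hy =>
      rw [map_add]
      exact (map_add (DirectSum.of (fun i => pureGrading k C i) 0) ⟨_, _⟩ ⟨_, _⟩).trans
        (congrArg₂ (· + ·) hx hy)

theorem superCommutative_pureGrading (hC : ∀ a b : C, a * b = b * a) :
    SuperCommutative (pureGrading k C) where
  even_comm a _ b := hC a b
  odd_anticomm a ha b _ := by rw [(mem_pureGrading_one C).1 ha]; simp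

end Pure

variable (𝒜 : ZMod 2 → Submodule k A) [GradedAlgebra 𝒜]

/-- The subalgebra of even functions. -/
def evenSubalgebra : Subalgebra k A where
  carrier := 𝒜 0
  mul_mem' := mul_mem_of_even_even 𝒜
  one_mem' := SetLike.GradedOne.one_mem
  add_mem' := add_mem
  zero_mem' := zero_mem _
  algebraMap_mem' := SetLike.algebraMap_mem_graded 𝒜

variable [SuperCommutative 𝒜]

/-- The restriction homomorphism `k[X] → k[X₀]`. -/
def toEvenQuotient : A →ₐ[k] EvenQuotient 𝒜 := Ideal.Quotient.mkₐ k (oddIdeal 𝒜)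

theorem toEvenQuotient_surjective : Function.Surjective (toEvenQuotient 𝒜) :=
  Ideal.Quotient.mkₐ_surjective k (oddIdeal 𝒜)

theorem toEvenQuotient_eq_zero_iff (a : A) : toEvenQuotient 𝒜 a = 0 ↔ a ∈ oddIdeal 𝒜 :=
  Ideal.Quotient.eq_zero_iff_mem

theorem toEvenQuotient_odd {a : A} (ha : a ∈ 𝒜 1) : toEvenQuotient 𝒜 a = 0 :=
  (toEvenQuotient_eq_zero_iff 𝒜 a).2 (Ideal.subset_span ha)

/-- A smooth supervariety retracts onto its underlying even variety: the restriction `A → A/J` lifts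
along `A₀ → A/J`, and the lift kills the odd functions because `A₀` is purely even. -/
theorem exists_section [CharZero k] (hX : IsSmoothAffine 𝒜) :
    ∃ σ : EvenQuotient 𝒜 →ₐ[k] A, (∀ b, σ b ∈ 𝒜 0) ∧ ∀ b, toEvenQuotient 𝒜 (σ b) = b := by
  have hA := hX.finiteType
  have hcomm : ∀ a b : evenSubalgebra 𝒜, a * b = b * a := fun a b =>
    Subtype.ext (SuperCommutative.even_comm a.1 a.2 b.1)
  have _ : SuperCommutative (pureGrading k (evenSubalgebra 𝒜)) :=
    superCommutative_pureGrading _ hcomm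
  have _ : SuperCommutative (pureGrading k (EvenQuotient 𝒜)) :=
    superCommutative_pureGrading _ mul_comm
  let p : evenSubalgebra 𝒜 →ₐ[k] EvenQuotient 𝒜 := (toEvenQuotient 𝒜).comp (evenSubalgebra 𝒜).val
  have hp : Function.Surjective p := fun b => by
    obtain ⟨a, rfl⟩ := toEvenQuotient_surjective 𝒜 b
    obtain ⟨a₀, ha₀, a₁, ha₁, rfl⟩ := exists_even_add_odd 𝒜 a
    exact ⟨⟨a₀, ha₀⟩, by rw [map_add, toEvenQuotient_odd 𝒜 ha₁, add_zero]; rfl⟩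
  have hpure : ∀ i, ∀ a ∈ pureGrading k (evenSubalgebra 𝒜) i,
      p a ∈ pureGrading k (EvenQuotient 𝒜) i := fun i a ha => by
    rcases zmod_cases i with rfl | rfl
    · exact mem_pureGrading_zero _ _
    · rw [(mem_pureGrading_one _).1 ha, map_zero]
      exact zero_mem _
  have hnil : IsNilpotent (LinearMap.ker p.toLinearMap) := by
    obtain ⟨S, hf, hS, hJ⟩ := exists_finite_span_eq_oddIdeal 𝒜
    obtain ⟨N, hN⟩ := isNilpotent_top_mul_span_odd 𝒜 k hf hS
    refine ⟨N, ?_⟩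
    have hle : (LinearMap.ker p.toLinearMap).map (evenSubalgebra 𝒜).val.toLinearMap ≤
        ⊤ * Submodule.span k S := by
      rintro _ ⟨a, ha, rfl⟩
      refine (mem_top_mul_span_iff k).2 (hJ ▸ ?_)
      exact (toEvenQuotient_eq_zero_iff 𝒜 _).1 ha
    have h0 : ((LinearMap.ker p.toLinearMap) ^ N).map (evenSubalgebra 𝒜).val.toLinearMap ≤ ⊥ := by
      rw [Submodule.map_pow]
      exact (pow_le_pow_left' hle N).trans hN.le
    refine le_bot_iff.1 fun a ha => ?_
    have : (a : A) = 0 := h0 ⟨a, ha, rfl⟩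
    exact Subtype.ext this
  obtain ⟨g, hg, hgp⟩ := hX.exists_lift (evenSubalgebra 𝒜) (EvenQuotient 𝒜)
    (pureGrading k _) (pureGrading k _) p hpure hp hnil (toEvenQuotient 𝒜) fun i a ha => by
      rcases zmod_cases i with rfl | rfl
      · exact mem_pureGrading_zero _ _
      · exact (mem_pureGrading_one _).2 (toEvenQuotient_odd 𝒜 ha)
  have hker : ∀ a ∈ oddIdeal 𝒜, g a = 0 := fun a ha => by
    have hle : oddIdeal 𝒜 ≤ RingHom.ker g :=
      Ideal.span_le.2 fun b hb => (mem_pureGrading_one _).1 (hg 1 b hb)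
    exact hle ha
  let σ₀ : EvenQuotient 𝒜 →ₐ[k] evenSubalgebra 𝒜 := Ideal.Quotient.liftₐ (oddIdeal 𝒜) g hker
  have hσ₀ : ∀ a, σ₀ (toEvenQuotient 𝒜 a) = g a := fun a => rfl
  refine ⟨(evenSubalgebra 𝒜).val.comp σ₀, fun b => (σ₀ b).2, fun b => ?_⟩
  obtain ⟨a, rfl⟩ := toEvenQuotient_surjective 𝒜 b
  exact (congrArg p (hσ₀ a)).trans (AlgHom.congr_fun hgp a)

end Split

end SuperGeom

end

theorem mainTheorem6 {k : Type u} [Field k] [IsAlgClosed k] [CharZero k]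
    {A : Type v} [Ring A] [Algebra k A] (𝒜 : ZMod 2 → Submodule k A) [GradedAlgebra 𝒜]
    [SuperGeom.SuperCommutative 𝒜] (hX : SuperGeom.IsSmoothAffine 𝒜)
    (u : SuperGeom.OddVectorField 𝒜) (hu : u.IsHomological)
    (hvan : ∀ x : A →ₐ[k] k, u.VanishesAt x)
    (hodd : ∀ x : A →ₐ[k] k, ∀ ξ ∈ SuperGeom.cotangentPart 𝒜 x 1,
      SuperGeom.OddVectorField.cotangentMap (hvan x) ξ = 0)
    (heven : ∀ x : A →ₐ[k] k, Set.BijOn (SuperGeom.OddVectorField.cotangentMap (hvan x))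
      (SuperGeom.cotangentPart 𝒜 x 0) (SuperGeom.cotangentPart 𝒜 x 1)) :
    ∃ φ : A ≃ₐ[k] SuperGeom.Forms k (SuperGeom.EvenQuotient 𝒜),
      (∀ i a, a ∈ 𝒜 i ↔ φ a ∈ SuperGeom.Forms.parity k (SuperGeom.EvenQuotient 𝒜) i) ∧
      ∀ a, φ (u.toLinearMap a) = SuperGeom.deRham k (SuperGeom.EvenQuotient 𝒜) (φ a) := by
  obtain ⟨σ, hσ, hπσ⟩ := SuperGeom.exists_section 𝒜 hX
  -- Regard `A` as an algebra over the functions on the even part, via the retraction.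
  let _ : Algebra (SuperGeom.EvenQuotient 𝒜) A :=
    σ.toRingHom.toAlgebra' fun b a => SuperGeom.SuperCommutative.even_comm (σ b) (hσ b) a
  have _ : IsScalarTower k (SuperGeom.EvenQuotient 𝒜) A :=
    IsScalarTower.of_algebraMap_eq fun c => (σ.commutes c).symm
  let π : A →ₐ[SuperGeom.EvenQuotient 𝒜] SuperGeom.EvenQuotient 𝒜 :=
    { (SuperGeom.toEvenQuotient 𝒜).toRingHom with commutes' := hπσ }
  have hret : SuperGeom.IsRetract 𝒜 π := ⟨SuperGeom.toEvenQuotient_eq_zero_iff 𝒜, hσ⟩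
  exact SuperGeom.exists_equiv_of_isRetract u hret hX hu hvan hodd heven
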